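/- Let $X$ be a random vector in $\mathbb{R}^p$ and $Y$ a real random variable, let $(X_1,Y_1),(X_2,Y_2),\dots$ be independent copies of $(X,Y)$, and let $\alpha\in\mathbb{S}^{p-1}$ be a fixed unit vector. Assume that the distribution functions $F_{\alpha^{\mathsf T}X}$ of $\alpha^{\mathsf T}X$ and $F_Y$ of $Y$ are continuous. Population quantity. Let $c$ be the copula density of $(\alpha^{\mathsf T}X,Y)$, that is, the density with respect to Lebesgue measure of the law of $(F_{\alpha^{\mathsf T}X}(\alpha^{\mathsf T}X),F_Y(Y))$ on $[0,1]^2$ (the density of its absolutely continuous part, if this law also has a singular part). Put $$\mathcal B=\iint_{[0,1]^2}\sqrt{c(u,v)}\,du\,dv,\qquad H(\alpha^{\mathsf T}X,Y)=h(\mathcal B),\qquad h(x)=\frac{2}{x^2}\Big\{x^4+(4-3x^4)^{1/2}-2\Big\}^{1/2},$$ where $h(0)=1$ (the limit of $h$ at $0$) and the square root of a negative number, which can occur only for $x>1$, is read as $0$. Estimator. For a sample of size $n$, let $\hat F_{\alpha^{\mathsf T}X}(t)=\frac1{n+1}\sum_{i=1}^n I\{\alpha^{\mathsf T}X_i\le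 t\}$, $\hat F_Y(t)=\frac1{n+1}\sum_{i=1}^n I\{Y_i\le t\}$, $\hat U_i=(\hat F_{\alpha^{\mathsf T}X}(\alpha^{\mathsf T}X_i),\hat F_Y(Y_i))$, $\hat R_i=\min_{j\ne i}\|\hat U_j-\hat U_i\|_2$, and $$\hat{\mathcal B}_n=\frac{2\sqrt{n-1}}{n}\sum_{i=1}^n\hat R_i,\qquad \hat H_n(\alpha^{\mathsf T}X,Y)=h(\hat{\mathcal B}_n).$$ Then $\hat H_n(\alpha^{\mathsf T}X,Y)\to H(\alpha^{\mathsf T}X,Y)$ in probability as $n\to\infty$. -/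

import Mathlib

open MeasureTheory ProbabilityTheory Filter

noncomputable section

namespace HellingerSDR

/-- The plane `ℝ²` with its Euclidean norm and Lebesgue measure. -/
abbrev Plane : Type := EuclideanSpace ℝ (Fin 2)

/-- The unit square `[0,1]²`. -/
def unitSquare : Set Plane := {u | ∀ k, u k ∈ Set.Icc (0 : ℝ) 1}

/-- The copula of a pair `(V, Y)` of real random variables, as a probability distribution on the
plane: the law of `(F_V(V), F_Y(Y))`, where `F_V` and `F_Y` are the distribution functions. -/
def copula {Ω : Type*} [MeasurableSpace Ω] (P : Measure Ω) (V Y : Ω → ℝ) : Measure Plane :=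
  P.map fun ω => !₂[cdf (P.map V) (V ω), cdf (P.map Y) (Y ω)]

/-- The copula density: the density, with respect to Lebesgue measure, of the copula (of its
absolutely continuous part, if the copula also has a singular part). -/
def copulaDensity {Ω : Type*} [MeasurableSpace Ω] (P : Measure Ω) (V Y : Ω → ℝ) (u : Plane) : ℝ :=
  ((copula P V Y).rnDeriv volume u).toReal

/-- The Bhattacharyya affinity coefficient, the integral of `√c` over the unit square. -/
def bhattacharyya {Ω : Type*} [MeasurableSpace Ω] (P : Measure Ω) (V Y : Ω → ℝ) : ℝ :=
  ∫ u in unitSquare, √(copulaDensity P V Y u)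

/-- The map from the Bhattacharyya coefficient to the Hellinger correlation. At `0` it is given its
limit `1`, so that it is a continuous bijection of `[0,1]`. The square root of a negative
number (which can occur only for arguments above `1`) is `0`. -/
def hellingerMap (x : ℝ) : ℝ :=
  if x = 0 then 1 else 2 / x ^ 2 * √(x ^ 4 + √(4 - 3 * x ^ 4) - 2)

/-- The Hellinger correlation of the pair `(V, Y)`. -/
def hellingerCorrelation {Ω : Type*} [MeasurableSpace Ω] (P : Measure Ω) (V Y : Ω → ℝ) : ℝ :=
  hellingerMap (bhattacharyya P V Y)

/-- The empirical distribution function of `v₁, …, vₙ`, normalised by `n + 1`. -/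
def empiricalCdf {n : ℕ} (v : Fin n → ℝ) (t : ℝ) : ℝ :=
  1 / ((n : ℝ) + 1) * ∑ i, Set.indicator {s | s ≤ t} (fun _ => (1 : ℝ)) (v i)

/-- The rank-transformed data points `(F̂_V(vᵢ), F̂_Y(yᵢ))`. -/
def pseudoObs {n : ℕ} (v y : Fin n → ℝ) (i : Fin n) : Plane :=
  !₂[empiricalCdf v (v i), empiricalCdf y (y i)]

/-- The Euclidean distance from the `i`-th of `n` points to its nearest neighbour among the others
(meaningful for `n ≥ 2`). -/
def nnDist {n : ℕ} (u : Fin n → Plane) (i : Fin n) : ℝ :=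
  ⨅ j : {j : Fin n // j ≠ i}, ‖u j - u i‖

/-- The nearest-neighbour estimator of the Bhattacharyya coefficient. -/
def bhattacharyyaEst {n : ℕ} (v y : Fin n → ℝ) : ℝ :=
  2 * √((n : ℝ) - 1) / n * ∑ i, nnDist (pseudoObs v y) i

/-- The estimator of the Hellinger correlation. -/
def hellingerEst {n : ℕ} (v y : Fin n → ℝ) : ℝ :=
  hellingerMap (bhattacharyyaEst v y)

end HellingerSDR

end

namespace HellingerSDR

open scoped Topology ENNReal
open Set Metric

/-! ### The exponential limit of powers -/

/-! By the probability integral transform, continuous margins give a copula `μ` with uniform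
margins. Almost surely there are no ties, and ranks are invariant under monotone maps, so the
estimator may be computed from an i.i.d. sample of `μ`. Two things remain: nearest-neighbour
distances in that sample, and the effect of replacing it by its ranks.

Nearest neighbours: for `μ`-almost every `u`, Besicovitch differentiation gives `n μ(B(u, s/√n)) → π
s² κ(u)`, with `κ` the local density, infinite on the singular part. Hence a sample point has no
neighbour within `s/√n` with probability tending to `∫ exp(-π s² κ) dμ`. Two distinct points are
asymptotically independent in this respect, so a second moment argument yields convergence in
probability of the fraction of isolated points (`tendsto_isolated_frequency`). Integrating over `s`
gives `∫ 1/(2√κ) dμ`, which is half the integral of `√c`; the singular part contributes nothing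
(`UniformMargins.integral_sqrt_rnDeriv`).

Ranks: the empirical distribution functions deviate globally by about `n^(-1/2)`, the very order of
the distances, so uniform closeness is useless. But distances involve only increments over windows
of width about `n^(-1/2)`, and these fluctuate by about `n^(-3/4)`. Chebyshev on a finite grid plus
monotonicity controls all distances truncated at `K/√n`
(`UniformMargins.tendsto_average_rankTransform`).

A packing bound in the square removes the truncation at cost `36/K`, with no moment or density
assumption (`sum_nnDist_sq_le`). Continuity of `h` finishes the proof. -/

/-- The function `x ↦ exp (-x)` on `[0, ∞]`. -/
noncomputable def expNeg (x : ℝ≥0∞) : ℝ := if x = ∞ then 0 else Real.exp (-x.toReal)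

theorem expNeg_nonneg (x : ℝ≥0∞) : 0 ≤ expNeg x := by
  unfold expNeg; split_ifs <;> positivity

theorem expNeg_le_one (x : ℝ≥0∞) : expNeg x ≤ 1 := by
  unfold expNeg
  split_ifs
  · exact zero_le_one
  · exact Real.exp_le_one_iff.2 (neg_nonpos.2 ENNReal.toReal_nonneg)

theorem expNeg_add (x y : ℝ≥0∞) : expNeg (x + y) = expNeg x * expNeg y := by
  unfold expNeg
  by_cases hx : x = ∞
  · simp [hx]
  by_cases hy : y = ∞
  · simp [hy]
  rw [if_neg (by simp [hx, hy]), if_neg hx, if_neg hy, ENNReal.toReal_add hx hy, neg_add,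
    Real.exp_add]

theorem measurable_expNeg : Measurable expNeg :=
  Measurable.ite (measurableSet_singleton _) measurable_const (by fun_prop)

/-- For finite `x` this is the classical limit; for `x = ∞` it follows from `(1 - p)^n ≤ exp(-np)`.
The infinite value occurs at points charged by the singular part of the copula. -/
theorem tendsto_one_sub_pow_expNeg {p : ℕ → ℝ≥0∞} (hp : ∀ n, p n ≤ 1) {x : ℝ≥0∞}
    (h : Tendsto (fun n : ℕ => (n : ℝ≥0∞) * p n) atTop (𝓝 x)) :
    Tendsto (fun n => (1 - (p n).toReal) ^ n) atTop (𝓝 (expNeg x)) := by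
  have htr : ∀ n : ℕ, ((n : ℝ≥0∞) * p n).toReal = n * (p n).toReal := fun n => by simp
  by_cases hx : x = ∞
  · subst hx
    have h1 : Tendsto (fun n : ℕ => (n : ℝ) * (p n).toReal) atTop atTop := by
      rw [Filter.tendsto_atTop]
      intro b
      filter_upwards [h.eventually (lt_mem_nhds (ENNReal.ofReal_lt_top (r := b)))] with n hn
      rw [← htr]
      exact (ENNReal.ofReal_le_iff_le_toReal (ENNReal.mul_ne_top (by simp)
        (ne_top_of_le_ne_top ENNReal.one_ne_top (hp n)))).1 hn.le
    have h2 : Tendsto (fun n : ℕ => Real.exp (-((n : ℝ) * (p n).toReal))) atTop (𝓝 0) :=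
      Real.tendsto_exp_neg_atTop_nhds_zero.comp h1
    simp only [expNeg, if_true]
    have hle : ∀ n, 0 ≤ 1 - (p n).toReal := fun n =>
      sub_nonneg.2 (ENNReal.toReal_le_of_le_ofReal zero_le_one (by simpa using hp n))
    refine squeeze_zero (fun n => pow_nonneg (hle n) n) (fun n => ?_) h2
    calc (1 - (p n).toReal) ^ n ≤ (Real.exp (-(p n).toReal)) ^ n := by
          refine pow_le_pow_left₀ (hle n) ?_ n
          linarith [Real.add_one_le_exp (-(p n).toReal)]
      _ = _ := by rw [← Real.exp_nat_mul]; ring_nf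
  · simp only [expNeg, if_neg hx]
    have h1 := (ENNReal.tendsto_toReal hx).comp h
    have h2 := Real.tendsto_one_add_pow_exp_of_tendsto (g := fun n => -(p n).toReal)
      (t := -x.toReal) (by
        convert h1.neg using 2 with n
        simp)
    simpa [sub_eq_add_neg] using h2

/-! ### Conditioning on one coordinate of an i.i.d. sample -/

section Conditioning

variable {E : Type*} [MeasurableSpace E] (μ : Measure E) [IsProbabilityMeasure μ]

/-- The law of an i.i.d. sample of size `n`. -/
noncomputable abbrev sampleLaw (n : ℕ) : Measure (Fin n → E) := Measure.pi fun _ => μ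

/-- Fubini after splitting off coordinate `i`: given the `i`-th point, the others are still i.i.d.
with law `μ`. -/
theorem sampleLaw_cond {n : ℕ} (i : Fin (n + 1)) {D : Set (E × (Fin n → E))}
    (hD : MeasurableSet D) :
    sampleLaw μ (n + 1) {x | (x i, fun j => x (i.succAbove j)) ∈ D} =
      ∫⁻ u, sampleLaw μ n (Prod.mk u ⁻¹' D) ∂μ := by
  have h := measurePreserving_piFinSuccAbove (fun _ : Fin (n + 1) => μ) i
  rw [← Measure.prod_apply hD, ← h.measure_preimage hD.nullMeasurableSet]
  rfl

theorem sampleLaw_cond_real {n : ℕ} (i : Fin (n + 1)) {D : Set (E × (Fin n → E))}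
    (hD : MeasurableSet D) :
    (sampleLaw μ (n + 1)).real {x | (x i, fun j => x (i.succAbove j)) ∈ D} =
      ∫ u, (sampleLaw μ n).real (Prod.mk u ⁻¹' D) ∂μ := by
  simp only [measureReal_def]
  rw [integral_toReal (measurable_measure_prodMk_left hD).aemeasurable
    (ae_of_all _ fun u => measure_lt_top _ _), sampleLaw_cond μ i hD]

theorem sampleLaw_forall_mem {n : ℕ} (s : Set E) :
    (sampleLaw μ n).real {x | ∀ j, x j ∈ s} = μ.real s ^ n := by
  have : {x : Fin n → E | ∀ j, x j ∈ s} = univ.pi fun _ => s := by ext; simp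
  rw [this, measureReal_def, Measure.pi_pi]
  simp [measureReal_def]

/-- Chebyshev with the second moment kept explicit: for the indicator differences used later it is
as small as the window width, which is what makes the local comparison work. -/
theorem sampleLaw_sum_concentration {n : ℕ} {f : E → ℝ} (hf : MemLp f 2 μ) {c : ℝ} (hc : 0 < c) :
    (sampleLaw μ n).real {x | c ≤ |∑ j, f (x j) - n * ∫ u, f u ∂μ|} ≤
      n * (∫ u, f u ^ 2 ∂μ) / c ^ 2 := by
  have hvar : Var[∑ j, fun x : Fin n → E => f (x j); sampleLaw μ n] ≤ n * ∫ u, f u ^ 2 ∂μ := by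
    rw [variance_sum_pi (fun _ => hf)]
    simp only [Finset.sum_const, Finset.card_univ, Fintype.card_fin, nsmul_eq_mul]
    gcongr
    exact variance_le_expectation_sq hf.aestronglyMeasurable
  have hmem : ∀ j : Fin n, MemLp (fun x : Fin n → E => f (x j)) 2 (sampleLaw μ n) := fun j =>
    hf.comp_measurePreserving (measurePreserving_eval _ j)
  have hL : MemLp (∑ j, fun x : Fin n → E => f (x j)) 2 (sampleLaw μ n) :=
    memLp_finsetSum' _ fun j _ => hmem j
  have hmean : ∫ x, (∑ j, fun x : Fin n → E => f (x j)) x ∂(sampleLaw μ n) =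
      n * ∫ u, f u ∂μ := by
    simp only [Finset.sum_apply]
    rw [integral_finsetSum _ fun j _ => (hmem j).integrable (by norm_num)]
    have : ∀ j : Fin n, ∫ x, f (x j) ∂(sampleLaw μ n) = ∫ u, f u ∂μ := fun j => by
      have h := measurePreserving_eval (fun _ : Fin n => μ) j
      conv_rhs => rw [← h.map_eq]
      rw [integral_map h.measurable.aemeasurable (by rw [h.map_eq]; exact hf.aestronglyMeasurable)]
    simp [this]
  have h := meas_ge_le_variance_div_sq hL hc
  rw [hmean] at h
  simp only [Finset.sum_apply] at h
  refine (ENNReal.toReal_mono ENNReal.ofReal_ne_top h).trans ?_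
  rw [ENNReal.toReal_ofReal (div_nonneg (variance_nonneg _ _) (sq_nonneg _))]
  gcongr

/-- Chebyshev's inequality for the fraction of events that occur, in a family of events with equal
probabilities. -/
theorem measure_abs_frequency_sub_ge_le {Ω : Type*} [MeasurableSpace Ω] (Q : Measure Ω)
    [IsProbabilityMeasure Q] {n : ℕ} {A : Fin (n + 1) → Set Ω} (hA : ∀ i, MeasurableSet (A i))
    {a b S ε : ℝ} (hb : 0 ≤ b) (ha : ∀ i, Q.real (A i) = a)
    (hab : ∀ i k, i ≠ k → Q.real (A i ∩ A k) ≤ b) (hε : 0 < ε) :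
    Q.real {x | ε ≤ |(∑ i, (A i).indicator 1 x) / ((n : ℝ) + 1) - S|} ≤
      (1 / ((n : ℝ) + 1) + b - 2 * S * a + S ^ 2) / ε ^ 2 := by
  have hi : ∀ i, Integrable ((A i).indicator (1 : Ω → ℝ)) Q := fun i =>
    (integrable_const (1 : ℝ)).indicator (hA i)
  have hik : ∀ i k, Integrable ((A i ∩ A k).indicator (1 : Ω → ℝ)) Q := fun i k =>
    (integrable_const (1 : ℝ)).indicator ((hA i).inter (hA k))
  have hsq : ∀ x, ((∑ i, (A i).indicator (1 : Ω → ℝ) x) / ((n : ℝ) + 1) - S) ^ 2 =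
      (∑ i, ∑ k, (A i ∩ A k).indicator (1 : Ω → ℝ) x) / ((n : ℝ) + 1) ^ 2
        - 2 * S / ((n : ℝ) + 1) * (∑ i, (A i).indicator (1 : Ω → ℝ) x) + S ^ 2 := fun x => by
    have : ∑ i, ∑ k, (A i ∩ A k).indicator (1 : Ω → ℝ) x =
        (∑ i, (A i).indicator (1 : Ω → ℝ) x) ^ 2 := by
      rw [sq, Finset.sum_mul_sum]
      simp only [Set.inter_indicator_one, Pi.mul_apply]
    rw [this]
    field_simp
    ring
  have hI1 : Integrable (fun x => (∑ i, ∑ k, (A i ∩ A k).indicator (1 : Ω → ℝ) x) /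
      ((n : ℝ) + 1) ^ 2) Q :=
    (integrable_finsetSum _ fun i _ => integrable_finsetSum _ fun k _ => hik i k).div_const _
  have hI2 : Integrable (fun x => 2 * S / ((n : ℝ) + 1) *
      (∑ i, (A i).indicator (1 : Ω → ℝ) x)) Q :=
    (integrable_finsetSum _ fun i _ => hi i).const_mul _
  have hint : Integrable
      (fun x => ((∑ i, (A i).indicator (1 : Ω → ℝ) x) / ((n : ℝ) + 1) - S) ^ 2) Q := by
    simp only [hsq]
    exact (hI1.sub hI2).add (integrable_const _)
  have hval : ∫ x, ((∑ i, (A i).indicator (1 : Ω → ℝ) x) / ((n : ℝ) + 1) - S) ^ 2 ∂Q ≤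
      1 / ((n : ℝ) + 1) + b - 2 * S * a + S ^ 2 := by
    simp only [hsq]
    rw [integral_add (by exact hI1.sub hI2) (integrable_const _), integral_sub hI1 hI2,
      integral_div,
      integral_const_mul, integral_finsetSum _ fun i _ => hi i,
      integral_finsetSum _ fun i _ => integrable_finsetSum _ fun k _ => hik i k]
    simp only [integral_finsetSum _ fun k _ => hik _ k]
    simp only [integral_indicator_one (hA _), integral_indicator_one ((hA _).inter (hA _)), ha]
    -- The diagonal pairs, bounded trivially by one, are only `n + 1` out of `(n + 1)²`; they give
    -- the term `1 / (n + 1)`.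
    have hbound : ∑ i, ∑ k, Q.real (A i ∩ A k) ≤ ((n : ℝ) + 1) + ((n : ℝ) + 1) ^ 2 * b := by
      calc ∑ i, ∑ k, Q.real (A i ∩ A k)
          ≤ ∑ i : Fin (n + 1), ∑ k : Fin (n + 1), ((if i = k then 1 else 0) + b) := by
            refine Finset.sum_le_sum fun i _ => Finset.sum_le_sum fun k _ => ?_
            split_ifs with h
            · have : Q.real (A i ∩ A k) ≤ 1 := measureReal_le_one
              linarith
            · simpa using hab i k h
        _ = _ := by simp [Finset.sum_add_distrib]; ring
    have hn : (0 : ℝ) < (n : ℝ) + 1 := by positivity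
    have : (∑ i, ∑ k, Q.real (A i ∩ A k)) / ((n : ℝ) + 1) ^ 2 ≤ 1 / ((n : ℝ) + 1) + b := by
      rw [div_le_iff₀ (by positivity)]
      refine hbound.trans (le_of_eq ?_)
      field_simp
    simp only [Finset.sum_const, Finset.card_univ, Fintype.card_fin, nsmul_eq_mul, integral_const,
      probReal_univ, smul_eq_mul, one_mul]
    have h2 : 2 * S / ((n : ℝ) + 1) * (((n + 1 : ℕ) : ℝ) * a) = 2 * S * a := by
      push_cast; field_simp
    rw [h2]
    linarith
  have hm := mul_meas_ge_le_integral_of_nonneg (ae_of_all Q fun x => sq_nonneg _) hint (ε ^ 2)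
  rw [le_div_iff₀ (by positivity), mul_comm]
  refine le_trans ?_ (hm.trans hval)
  refine mul_le_mul_of_nonneg_left (measureReal_mono fun x hx => ?_) (sq_nonneg ε)
  simp only [mem_ofPred_eq] at hx ⊢
  rw [← sq_abs (_ - S)]
  exact pow_le_pow_left₀ hε.le hx 2

end Conditioning

/-! ### Nearest-neighbour distances of an i.i.d. sample in the plane -/

section Isolated

/-- The density of `μ` with respect to Lebesgue measure, with value `∞` on the singular part. -/
noncomputable def localDensity (μ : Measure Plane) (u : Plane) : ℝ≥0∞ := (volume.rnDeriv μ u)⁻¹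

theorem measurable_localDensity (μ : Measure Plane) : Measurable (localDensity μ) :=
  (Measure.measurable_rnDeriv _ _).inv

variable (μ : Measure Plane) [IsProbabilityMeasure μ]

/-- Differentiating Lebesgue measure with respect to `μ`, rather than the reverse, gives a statement
`μ`-almost everywhere without absolute continuity. On the singular part the derivative is zero and
its inverse correctly gives the limit `∞`. -/
theorem ae_tendsto_mul_measure_closedBall :
    ∀ᵐ u ∂μ, ∀ (s : ℝ) (r : ℕ → ℝ), 0 < s → (∀ᶠ n in atTop, 0 < r n) → Tendsto r atTop (𝓝 0) →
      Tendsto (fun n : ℕ => (n : ℝ) * r n ^ 2) atTop (𝓝 (s ^ 2)) →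
      Tendsto (fun n : ℕ => (n : ℝ≥0∞) * μ (closedBall u (r n))) atTop
        (𝓝 (ENNReal.ofReal (Real.pi * s ^ 2) * localDensity μ u)) := by
  filter_upwards [Besicovitch.ae_tendsto_rnDeriv (volume : Measure Plane) μ,
    Measure.rnDeriv_ne_top (volume : Measure Plane) μ] with u hu hfin s r hs hr hr0 hrs
  have h1 : Tendsto (fun n => volume (closedBall u (r n)) / μ (closedBall u (r n))) atTop
      (𝓝 (volume.rnDeriv μ u)) :=
    hu.comp (tendsto_nhdsWithin_iff.2 ⟨hr0, hr⟩)
  have h2 : Tendsto (fun n : ℕ => ENNReal.ofReal (Real.pi * (n * r n ^ 2))) atTop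
      (𝓝 (ENNReal.ofReal (Real.pi * s ^ 2))) :=
    ENNReal.tendsto_ofReal (hrs.const_mul _)
  have hpos : ENNReal.ofReal (Real.pi * s ^ 2) ≠ 0 := by
    simp only [ne_eq, ENNReal.ofReal_eq_zero, not_le]; positivity
  have h3 := ENNReal.Tendsto.mul h2 (Or.inl hpos) (tendsto_inv_iff.2 h1)
    (Or.inr ENNReal.ofReal_ne_top)
  refine h3.congr' ?_
  filter_upwards [hr] with n hn
  have hvol : volume (closedBall u (r n)) = ENNReal.ofReal (Real.pi * r n ^ 2) := by
    rw [EuclideanSpace.volume_closedBall_fin_two, ← ENNReal.ofReal_pow hn.le,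
      ← ENNReal.ofReal_mul (by positivity), mul_comm]
  have hv0 : volume (closedBall u (r n)) ≠ 0 := by
    rw [hvol]; simp only [ne_eq, ENNReal.ofReal_eq_zero, not_le]; positivity
  have hvt : volume (closedBall u (r n)) ≠ ∞ := by rw [hvol]; exact ENNReal.ofReal_ne_top
  have : ENNReal.ofReal (Real.pi * (n * r n ^ 2)) = n * volume (closedBall u (r n)) := by
    rw [hvol, mul_left_comm, ENNReal.ofReal_mul (by positivity), ENNReal.ofReal_natCast]
  rw [this, ENNReal.inv_div (Or.inr hvt) (Or.inr hv0), mul_assoc, ENNReal.mul_div_cancel hv0 hvt]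

theorem measurable_measureReal_closedBall (r : ℝ) :
    Measurable fun u : Plane => μ.real (closedBall u r) := by
  have hS : MeasurableSet {w : Plane × Plane | dist w.2 w.1 ≤ r} :=
    measurableSet_le (by fun_prop) measurable_const
  exact (measurable_measure_prodMk_left (ν := μ) hS).ennreal_toReal

theorem measurable_measureReal_closedBall_union (r : ℝ) :
    Measurable fun z : Plane × Plane => μ.real (closedBall z.1 r ∪ closedBall z.2 r) := by
  have hS : MeasurableSet {w : (Plane × Plane) × Plane |
      dist w.2 w.1.1 ≤ r ∨ dist w.2 w.1.2 ≤ r} := by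
    rw [ofPred_or]
    exact (measurableSet_le (by fun_prop) measurable_const).union
      (measurableSet_le (by fun_prop) measurable_const)
  exact (measurable_measure_prodMk_left (ν := μ) hS).ennreal_toReal

theorem norm_one_sub_measureReal_pow_le (t : Set Plane) (n : ℕ) :
    ‖(1 - μ.real t) ^ n‖ ≤ 1 := by
  have h1 : μ.real t ≤ 1 := measureReal_le_one
  rw [Real.norm_eq_abs, abs_pow]
  refine pow_le_one₀ (abs_nonneg _) (abs_le.2 ⟨by linarith, ?_⟩)
  linarith [measureReal_nonneg (μ := μ) (s := t)]

/-- The event that no other sample point lies within distance `r` of the `i`-th one. -/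
def isolated {n : ℕ} (i : Fin (n + 1)) (r : ℝ) : Set (Fin (n + 1) → Plane) :=
  {x | ∀ j : Fin n, r < dist (x (i.succAbove j)) (x i)}

theorem measurableSet_isolated {n : ℕ} (i : Fin (n + 1)) (r : ℝ) :
    MeasurableSet (isolated i r) := by
  unfold isolated
  rw [ofPred_forall]
  exact MeasurableSet.iInter fun j => measurableSet_lt measurable_const (by fun_prop)

theorem sampleLaw_isolated {n : ℕ} (i : Fin (n + 1)) (r : ℝ) :
    (sampleLaw μ (n + 1)).real (isolated i r) = ∫ u, (1 - μ.real (closedBall u r)) ^ n ∂μ := by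
  have hD : MeasurableSet {z : Plane × (Fin n → Plane) | ∀ j, r < dist (z.2 j) z.1} := by
    rw [ofPred_forall]
    exact MeasurableSet.iInter fun j => measurableSet_lt measurable_const (by fun_prop)
  have h := sampleLaw_cond_real μ i hD
  refine h.trans ?_
  congr with u
  rw [← probReal_compl_eq_one_sub measurableSet_closedBall, ← sampleLaw_forall_mem]
  congr with y
  simp

/-- Given points `i` and `k`, the other `n` must avoid both balls. The condition that these two
points are themselves far apart is dropped, hence an inequality; the second moment bound needs no
more. -/
theorem sampleLaw_isolated_inter_le {n : ℕ} {i k : Fin (n + 2)} (hik : i ≠ k) (r : ℝ) :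
    (sampleLaw μ (n + 2)).real (isolated i r ∩ isolated k r) ≤
      ∫ z, (1 - μ.real (closedBall z.1 r ∪ closedBall z.2 r)) ^ n ∂(μ.prod μ) := by
  obtain ⟨k, rfl⟩ := Fin.exists_succAbove_eq hik.symm
  set D : Set (Plane × (Fin (n + 1) → Plane)) :=
    {z | ∀ j, r < dist (z.2 (k.succAbove j)) z.1 ∧ r < dist (z.2 (k.succAbove j)) (z.2 k)} with hDdef
  have hD : MeasurableSet D := by
    rw [hDdef, ofPred_forall]
    refine MeasurableSet.iInter fun j => ?_
    rw [ofPred_and]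
    exact (measurableSet_lt measurable_const (by fun_prop)).inter
      (measurableSet_lt measurable_const (by fun_prop))
  calc (sampleLaw μ (n + 2)).real (isolated i r ∩ isolated (i.succAbove k) r)
      ≤ (sampleLaw μ (n + 2)).real {x | (x i, fun j => x (i.succAbove j)) ∈ D} := by
        refine measureReal_mono fun x hx j => ⟨hx.1 _, ?_⟩
        have hne : i.succAbove (k.succAbove j) ≠ i.succAbove k := fun h =>
          Fin.succAbove_ne k j (Fin.succAbove_right_injective h)
        obtain ⟨l, hl⟩ := Fin.exists_succAbove_eq hne
        simp only
        rw [← hl]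
        exact hx.2 l
    _ = ∫ u, (sampleLaw μ (n + 1)).real (Prod.mk u ⁻¹' D) ∂μ := sampleLaw_cond_real μ i hD
    _ = ∫ u, ∫ v, (1 - μ.real (closedBall u r ∪ closedBall v r)) ^ n ∂μ ∂μ := by
        congr with u
        have hD' : MeasurableSet {z : Plane × (Fin n → Plane) |
            ∀ j, r < dist (z.2 j) u ∧ r < dist (z.2 j) z.1} := by
          rw [ofPred_forall]
          refine MeasurableSet.iInter fun j => ?_
          rw [ofPred_and]
          exact (measurableSet_lt measurable_const (by fun_prop)).inter
            (measurableSet_lt measurable_const (by fun_prop))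
        refine (sampleLaw_cond_real μ k hD').trans ?_
        congr with v
        rw [← probReal_compl_eq_one_sub (measurableSet_closedBall.union measurableSet_closedBall),
          ← sampleLaw_forall_mem]
        congr with y
        simp
    _ = _ := by
        refine (integral_prod (fun z : Plane × Plane =>
          (1 - μ.real (closedBall z.1 r ∪ closedBall z.2 r)) ^ n) ?_).symm
        exact Integrable.of_bound (C := 1) ((measurable_const.sub
          (measurable_measureReal_closedBall_union μ r)).pow_const n).aestronglyMeasurable
          (ae_of_all _ fun z => norm_one_sub_measureReal_pow_le μ _ n)

/-! ### Law of large numbers for the fraction of isolated points -/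

/-- The limit of the probability that the nearest-neighbour distance, multiplied by the square root
of the sample size, exceeds `s`. -/
noncomputable def isolationProb (s : ℝ) : ℝ :=
  ∫ u, expNeg (ENNReal.ofReal (Real.pi * s ^ 2) * localDensity μ u) ∂μ

theorem tendsto_integral_one_sub_closedBall_pow {s : ℝ} (hs : 0 < s) {r : ℕ → ℝ}
    (hr : ∀ᶠ n in atTop, 0 < r n) (hr0 : Tendsto r atTop (𝓝 0))
    (hrs : Tendsto (fun n : ℕ => (n : ℝ) * r n ^ 2) atTop (𝓝 (s ^ 2))) :
    Tendsto (fun n => ∫ u, (1 - μ.real (closedBall u (r n))) ^ n ∂μ) atTop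
      (𝓝 (isolationProb μ s)) := by
  refine tendsto_integral_of_dominated_convergence (fun _ => 1)
    (fun n => ((measurable_const.sub
      (measurable_measureReal_closedBall μ (r n))).pow_const n).aestronglyMeasurable)
    (integrable_const _) (fun n => ae_of_all _ fun u => norm_one_sub_measureReal_pow_le μ _ n) ?_
  filter_upwards [ae_tendsto_mul_measure_closedBall μ] with u hu
  exact tendsto_one_sub_pow_expNeg (fun n => prob_le_one) (hu s r hs hr hr0 hrs)

/-- Asymptotic independence: the diagonal is null for an atomless `μ`, and around distinct centres
the balls are eventually disjoint, so their masses add and `expNeg` turns the sum into a product. -/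
theorem tendsto_integral_one_sub_closedBall_union_pow [NullSingletonClass μ] {s : ℝ} (hs : 0 < s) {r : ℕ → ℝ}
    (hr : ∀ᶠ n in atTop, 0 < r n) (hr0 : Tendsto r atTop (𝓝 0))
    (hrs : Tendsto (fun n : ℕ => (n : ℝ) * r n ^ 2) atTop (𝓝 (s ^ 2))) :
    Tendsto (fun n => ∫ z, (1 - μ.real (closedBall z.1 (r n) ∪ closedBall z.2 (r n))) ^ n
      ∂(μ.prod μ)) atTop (𝓝 (isolationProb μ s ^ 2)) := by
  have hsq : isolationProb μ s ^ 2 = ∫ z : Plane × Plane,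
      expNeg (ENNReal.ofReal (Real.pi * s ^ 2) * localDensity μ z.1 +
        ENNReal.ofReal (Real.pi * s ^ 2) * localDensity μ z.2) ∂(μ.prod μ) := by
    simp only [expNeg_add]
    rw [integral_prod_mul (fun u => expNeg (ENNReal.ofReal (Real.pi * s ^ 2) * localDensity μ u))
      (fun u => expNeg (ENNReal.ofReal (Real.pi * s ^ 2) * localDensity μ u)), sq]
    rfl
  rw [hsq]
  refine tendsto_integral_of_dominated_convergence (fun _ => 1)
    (fun n => ((measurable_const.sub
      (measurable_measureReal_closedBall_union μ (r n))).pow_const n).aestronglyMeasurable)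
    (integrable_const _) (fun n => ae_of_all _ fun z => norm_one_sub_measureReal_pow_le μ _ n) ?_
  have hne : ∀ᵐ z ∂(μ.prod μ), z.1 ≠ z.2 := by
    have : (μ.prod μ) {z : Plane × Plane | z.1 = z.2} = 0 := by
      rw [Measure.prod_apply (measurableSet_eq_fun measurable_fst measurable_snd)]
      refine lintegral_eq_zero_of_ae_eq_zero (ae_of_all _ fun u => ?_)
      have : Prod.mk u ⁻¹' {z : Plane × Plane | z.1 = z.2} = {u} := by
        ext v; simp [eq_comm]
      simp [this]
    exact measure_eq_zero_iff_ae_notMem.1 this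
  have h1 := (Measure.quasiMeasurePreserving_fst (μ := μ) (ν := μ)).ae
    (ae_tendsto_mul_measure_closedBall μ)
  have h2 := (Measure.quasiMeasurePreserving_snd (μ := μ) (ν := μ)).ae
    (ae_tendsto_mul_measure_closedBall μ)
  filter_upwards [hne, h1, h2] with z hz hz1 hz2
  refine tendsto_one_sub_pow_expNeg (p := fun n => μ (closedBall z.1 (r n) ∪ closedBall z.2 (r n)))
    (fun n => prob_le_one) ?_
  refine ((hz1 s r hs hr hr0 hrs).add (hz2 s r hs hr hr0 hrs)).congr' ?_
  have hd : 0 < dist z.1 z.2 / 2 := by have := dist_pos.2 hz; linarith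
  filter_upwards [hr0.eventually (gt_mem_nhds hd)] with n hn
  rw [measure_union (closedBall_disjoint_closedBall (by linarith)) measurableSet_closedBall, mul_add]

theorem tendsto_div_sqrt_add (s : ℝ) (c : ℕ) :
    Tendsto (fun n : ℕ => s / √((n + c : ℕ) : ℝ)) atTop (𝓝 0) := by
  refine Tendsto.div_atTop tendsto_const_nhds (Real.tendsto_sqrt_atTop.comp
    (tendsto_natCast_atTop_atTop.comp (tendsto_add_atTop_nat c)))

theorem tendsto_mul_div_sqrt_add_sq (s : ℝ) (c : ℕ) :
    Tendsto (fun n : ℕ => (n : ℝ) * (s / √((n + c : ℕ) : ℝ)) ^ 2) atTop (𝓝 (s ^ 2)) := by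
  have h := (tendsto_natCast_div_add_atTop (c : ℝ)).mul_const (s ^ 2)
  rw [one_mul] at h
  refine h.congr fun n => ?_
  rw [div_pow, Real.sq_sqrt (Nat.cast_nonneg _)]
  push_cast
  ring

theorem eventually_div_sqrt_add_pos {s : ℝ} (hs : 0 < s) (c : ℕ) :
    ∀ᶠ n : ℕ in atTop, 0 < s / √((n + c : ℕ) : ℝ) := by
  filter_upwards [eventually_ge_atTop 1] with n hn
  have : (0 : ℝ) < ((n + c : ℕ) : ℝ) := by exact_mod_cast (by omega)
  positivity

theorem tendsto_isolated_frequency [NullSingletonClass μ] {s ε : ℝ} (hs : 0 < s) (hε : 0 < ε) :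
    Tendsto (fun n : ℕ => (sampleLaw μ (n + 1)).real {x | ε ≤
      |(∑ i, (isolated i (s / √(n : ℝ))).indicator 1 x) / ((n : ℝ) + 1) - isolationProb μ s|})
      atTop (𝓝 0) := by
  -- With `n + 2` points and radius `s / √(n + 1)`, conditioning on one point leaves `n + 1` factors
  -- and on two leaves `n`; hence the offsets `0` and `1` below.
  rw [← tendsto_add_atTop_iff_nat 1]
  set S := isolationProb μ s
  have ha : Tendsto (fun n : ℕ => ∫ u, (1 - μ.real (closedBall u (s / √((n + 0 : ℕ) : ℝ)))) ^ n ∂μ)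
      atTop (𝓝 S) :=
    tendsto_integral_one_sub_closedBall_pow μ hs (eventually_div_sqrt_add_pos hs 0)
      (tendsto_div_sqrt_add s 0) (tendsto_mul_div_sqrt_add_sq s 0)
  have ha' := (tendsto_add_atTop_iff_nat 1).2 ha
  have hb := tendsto_integral_one_sub_closedBall_union_pow μ hs (eventually_div_sqrt_add_pos hs 1)
      (tendsto_div_sqrt_add s 1) (tendsto_mul_div_sqrt_add_sq s 1)
  have hinv : Tendsto (fun n : ℕ => 1 / (((n + 1 : ℕ) : ℝ) + 1)) atTop (𝓝 0) :=
    (tendsto_add_atTop_iff_nat 1).2 tendsto_one_div_add_atTop_nhds_zero_nat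
  have hlim := ((((hinv.add hb).sub (ha'.const_mul (2 * S))).add_const (S ^ 2)).div_const (ε ^ 2))
  have h0 : (0 + S ^ 2 - 2 * S * S + S ^ 2) / ε ^ 2 = 0 := by ring_nf
  rw [h0] at hlim
  refine squeeze_zero (fun n => measureReal_nonneg) (fun n => ?_) hlim
  refine measure_abs_frequency_sub_ge_le _ (fun i => measurableSet_isolated i _) ?_
    (fun i => sampleLaw_isolated μ i _) (fun i k hik => sampleLaw_isolated_inter_le μ hik _) hε
  refine integral_nonneg fun z => pow_nonneg (sub_nonneg.2 measureReal_le_one) _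

end Isolated

/-! ### Rank-transformed samples -/

theorem empiricalCdf_eq {n : ℕ} (v : Fin n → ℝ) (t : ℝ) :
    empiricalCdf v t = (∑ j, if v j ≤ t then (1 : ℝ) else 0) / ((n : ℝ) + 1) := by
  unfold empiricalCdf
  rw [one_div, inv_mul_eq_div]
  congr 1

theorem monotone_empiricalCdf {n : ℕ} (v : Fin n → ℝ) : Monotone (empiricalCdf v) := by
  intro s t hst
  rw [empiricalCdf_eq, empiricalCdf_eq]
  gcongr with j
  split_ifs with h1 h2
  · exact le_rfl
  · exact absurd (h1.trans hst) h2
  · exact zero_le_one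
  · exact le_rfl

theorem empiricalCdf_mem_Icc {n : ℕ} (v : Fin n → ℝ) (t : ℝ) :
    empiricalCdf v t ∈ Icc (0 : ℝ) 1 := by
  rw [empiricalCdf_eq]
  have h0 : 0 ≤ ∑ j, if v j ≤ t then (1 : ℝ) else 0 :=
    Finset.sum_nonneg fun j _ => by split_ifs <;> norm_num
  have h1 : (∑ j, if v j ≤ t then (1 : ℝ) else 0) ≤ n := by
    calc _ ≤ ∑ j : Fin n, (1 : ℝ) := Finset.sum_le_sum fun j _ => by split_ifs <;> norm_num
      _ = n := by simp
  exact ⟨by positivity, (div_le_one (by positivity)).2 (by linarith)⟩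

/-- The rank transform of a sample of points in the plane. -/
noncomputable def rankTransform {n : ℕ} (x : Fin n → Plane) : Fin n → Plane :=
  pseudoObs (fun i => x i 0) (fun i => x i 1)

theorem rankTransform_apply {n : ℕ} (x : Fin n → Plane) (i : Fin n) (k : Fin 2) :
    rankTransform x i k = empiricalCdf (fun j => x j k) (x i k) := by
  fin_cases k <;> rfl

theorem rankTransform_mem_unitSquare {n : ℕ} (x : Fin n → Plane) (i : Fin n) :
    rankTransform x i ∈ unitSquare := fun k => by
  rw [rankTransform_apply]; exact empiricalCdf_mem_Icc _ _

/-! ### Deterministic comparison of nearest-neighbour distances -/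

/-- Bracket `t` between neighbouring grid points: monotonicity adds at most one mesh width to the
error at the nodes. -/
theorem abs_sub_le_of_monotone_of_grid {Φ : ℝ → ℝ} (hΦ : Monotone Φ) {c h : ℝ} (hh : 0 < h) {M : ℕ}
    (H : ∀ l : ℤ, |l| ≤ M → |Φ (c + l * h) - l * h| ≤ h) {t : ℝ} (ht : |t - c| < M * h) :
    |Φ t - (t - c)| ≤ 2 * h := by
  set l := ⌊(t - c) / h⌋ with hl
  have h1 : (l : ℝ) * h ≤ t - c := (le_div_iff₀ hh).1 (Int.floor_le _)
  have h2 : t - c < (l + 1) * h := (div_lt_iff₀ hh).1 (Int.lt_floor_add_one _)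
  obtain ⟨h3, h4⟩ := abs_lt.1 ht
  have hlM : (l : ℝ) < M := by
    by_contra hc
    have := mul_le_mul_of_nonneg_right (not_lt.1 hc) hh.le
    linarith
  have hlM' : l + 1 ≤ (M : ℤ) := by
    have : l < (M : ℤ) := by exact_mod_cast hlM
    omega
  have hl0 : -(M : ℤ) ≤ l := by
    rw [hl, Int.le_floor, le_div_iff₀ hh]
    push_cast
    linarith
  have H1 := abs_le.1 (H l (abs_le.2 ⟨hl0, by omega⟩))
  have H2 := abs_le.1 (H (l + 1) (abs_le.2 ⟨by omega, hlM'⟩))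
  push_cast at H2
  have m1 : Φ (c + l * h) ≤ Φ t := hΦ (by linarith)
  have m2 : Φ t ≤ Φ (c + (l + 1) * h) := hΦ (by linarith)
  rw [abs_le]
  constructor <;> nlinarith

/-- By monotonicity the two end nodes alone ensure that a point outside the window stays far away
after the transform. -/
theorem le_abs_of_monotone_of_grid {Φ : ℝ → ℝ} (hΦ : Monotone Φ) {c h : ℝ} {M : ℕ}
    (H : ∀ l : ℤ, |l| ≤ M → |Φ (c + l * h) - l * h| ≤ h) {t : ℝ} (ht : M * h ≤ |t - c|) :
    M * h - h ≤ |Φ t| := by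
  rcases le_abs.1 ht with h1 | h1
  · have H1 := abs_le.1 (H M (by simp))
    push_cast at H1
    have m1 : Φ (c + M * h) ≤ Φ t := hΦ (by linarith)
    exact le_trans (by linarith) (le_abs_self _)
  · have H1 := abs_le.1 (H (-M) (by simp))
    push_cast at H1
    have m1 : Φ t ≤ Φ (c + -M * h) := hΦ (by linarith)
    exact le_trans (by linarith) (neg_le_abs _)

theorem Plane.norm_le_add (d : Plane) : ‖d‖ ≤ |d 0| + |d 1| := by
  rw [EuclideanSpace.norm_eq, Fin.sum_univ_two]
  refine Real.sqrt_le_iff.2 ⟨by positivity, ?_⟩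
  simp only [Real.norm_eq_abs]
  nlinarith [abs_nonneg (d 0), abs_nonneg (d 1)]

/-- Either every coordinate is inside the window, and two errors of `2h` add up, or some coordinate
is outside, and both norms exceed `K` so the truncations agree. -/
theorem abs_min_norm_sub_min_norm_le {d D : Plane} {h L K : ℝ} (hh : 0 ≤ h) (hK : K ≤ L - h)
    (h1 : ∀ k, |d k| < L → |D k - d k| ≤ 2 * h) (h2 : ∀ k, L ≤ |d k| → L - h ≤ |D k|) :
    |min ‖D‖ K - min ‖d‖ K| ≤ 4 * h := by
  by_cases hc : ∀ k, |d k| < L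
  · have hn : ‖D - d‖ ≤ 4 * h := by
      refine (Plane.norm_le_add _).trans ?_
      have e0 := h1 0 (hc 0)
      have e1 := h1 1 (hc 1)
      simp only [PiLp.sub_apply]
      linarith
    refine le_trans (abs_min_sub_min_le_max _ _ _ _) ?_
    simp only [sub_self, abs_zero]
    exact max_le ((abs_norm_sub_norm_le _ _).trans hn) (by linarith)
  · push Not at hc
    obtain ⟨k, hk⟩ := hc
    have hd : K ≤ ‖d‖ := by
      have := PiLp.norm_apply_le d k
      rw [Real.norm_eq_abs] at this
      linarith
    have hD : K ≤ ‖D‖ := by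
      have := PiLp.norm_apply_le D k
      rw [Real.norm_eq_abs] at this
      linarith [h2 k hk]
    rw [min_eq_right hd, min_eq_right hD, sub_self, abs_zero]
    linarith

theorem nnDist_nonneg {n : ℕ} (x : Fin n → Plane) (i : Fin n) : 0 ≤ nnDist x i :=
  Real.iInf_nonneg fun _ => norm_nonneg _

theorem nnDist_le {n : ℕ} (x : Fin n → Plane) {i j : Fin n} (h : j ≠ i) :
    nnDist x i ≤ ‖x j - x i‖ :=
  ciInf_le (f := fun j : {j : Fin n // j ≠ i} => ‖x j - x i‖) (Finite.bddBelow_range _) ⟨j, h⟩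

/-- A second point is needed: for a single one, `nnDist` is an infimum over the empty set, which is
`0`. -/
theorem exists_nnDist_eq {n : ℕ} (hn : 1 ≤ n) (x : Fin (n + 1) → Plane) (i : Fin (n + 1)) :
    ∃ j, j ≠ i ∧ ‖x j - x i‖ = nnDist x i := by
  have : Nonempty {j : Fin (n + 1) // j ≠ i} := ⟨⟨i.succAbove ⟨0, hn⟩, Fin.succAbove_ne _ _⟩⟩
  obtain ⟨⟨j, hj⟩, h⟩ := exists_eq_ciInf_of_finite
    (f := fun j : {j : Fin (n + 1) // j ≠ i} => ‖x j - x i‖)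
  exact ⟨j, hj, h⟩

theorem min_nnDist_le {n : ℕ} (hn : 1 ≤ n) {x y : Fin (n + 1) → Plane} {i : Fin (n + 1)} {K e : ℝ}
    (H : ∀ j, |min ‖y j - y i‖ K - min ‖x j - x i‖ K| ≤ e) :
    min (nnDist y i) K ≤ min (nnDist x i) K + e := by
  obtain ⟨j, hj, h⟩ := exists_nnDist_eq hn x i
  rw [← h]
  have h1 : min (nnDist y i) K ≤ min ‖y j - y i‖ K := min_le_min_right _ (nnDist_le y hj)
  linarith [(abs_le.1 (H j)).2]

theorem abs_min_nnDist_sub_le {n : ℕ} (hn : 1 ≤ n) {x y : Fin (n + 1) → Plane} {i : Fin (n + 1)}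
    {K e : ℝ} (H : ∀ j, |min ‖y j - y i‖ K - min ‖x j - x i‖ K| ≤ e) :
    |min (nnDist y i) K - min (nnDist x i) K| ≤ e := by
  have h1 := min_nnDist_le hn H
  have h2 := min_nnDist_le hn (x := y) (y := x) (i := i) (K := K) (e := e) fun j => by
    rw [abs_sub_comm]; exact H j
  rw [abs_le]; constructor <;> linarith

theorem nnDist_gt_iff_mem_isolated {n : ℕ} (hn : 1 ≤ n) (x : Fin (n + 1) → Plane) (i : Fin (n + 1))
    (r : ℝ) : r < nnDist x i ↔ x ∈ isolated i r := by
  constructor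
  · intro h j
    rw [dist_eq_norm]
    exact h.trans_le (nnDist_le x (Fin.succAbove_ne i j))
  · intro h
    obtain ⟨j, hj, hj'⟩ := exists_nnDist_eq hn x i
    obtain ⟨l, rfl⟩ := Fin.exists_succAbove_eq hj
    rw [← hj', ← dist_eq_norm]
    exact h l

/-! ### The ranks around a sample point -/

/-- The event that, at some grid point `x i k + l * h` with `|l| ≤ M`, the increment of the `k`-th
empirical distribution function from `x i k` differs from `l * h` by more than `h`. -/
def irregular {n : ℕ} (i : Fin (n + 1)) (h : ℝ) (M : ℕ) : Set (Fin (n + 1) → Plane) :=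
  ⋃ k : Fin 2, ⋃ l ∈ Finset.Icc (-(M : ℤ)) M, {x | h < |empiricalCdf (fun j => x j k) (x i k + l * h)
    - empiricalCdf (fun j => x j k) (x i k) - l * h|}

/-- Distances from point `i` depend only on increments of the empirical distribution functions from
that point, so their common deviation there cancels. -/
theorem abs_min_nnDist_rankTransform_sub_le {n : ℕ} (hn : 1 ≤ n) {i : Fin (n + 1)} {h K : ℝ} {M : ℕ}
    (hh : 0 < h) (hK : K ≤ M * h - h) {x : Fin (n + 1) → Plane} (hx : x ∉ irregular i h M) :
    |min (nnDist (rankTransform x) i) K - min (nnDist x i) K| ≤ 4 * h := by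
  have H : ∀ k : Fin 2, ∀ l : ℤ, |l| ≤ M → |empiricalCdf (fun j => x j k) (x i k + l * h)
      - empiricalCdf (fun j => x j k) (x i k) - l * h| ≤ h := by
    intro k l hl
    by_contra hc
    refine hx (mem_iUnion.2 ⟨k, mem_iUnion₂.2 ⟨l, ?_, not_le.1 hc⟩⟩)
    exact Finset.mem_Icc.2 (abs_le.1 hl)
  have hmono : ∀ k : Fin 2, Monotone fun t => empiricalCdf (fun j => x j k) t
      - empiricalCdf (fun j => x j k) (x i k) := fun k s t hst =>
    sub_le_sub_right (monotone_empiricalCdf _ hst) _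
  refine abs_min_nnDist_sub_le hn fun j => ?_
  refine abs_min_norm_sub_min_norm_le (L := M * h) hh.le hK (fun k hk => ?_) (fun k hk => ?_)
  · simp only [PiLp.sub_apply, rankTransform_apply] at hk ⊢
    exact abs_sub_le_of_monotone_of_grid (hmono k) hh (H k) hk
  · simp only [PiLp.sub_apply, rankTransform_apply] at hk ⊢
    exact le_abs_of_monotone_of_grid (hmono k) (H k) hk

/-! ### Concentration of local increments of the empirical distribution functions -/

section Irregular

/-- Both margins of `μ` are uniform on `[0, 1]`. -/
def UniformMargins (μ : Measure Plane) : Prop :=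
  ∀ k : Fin 2, μ.map (fun u => u k) = volume.restrict (Icc (0 : ℝ) 1)

variable {μ : Measure Plane} [IsProbabilityMeasure μ]

omit [IsProbabilityMeasure μ] in
theorem UniformMargins.measure_preimage (hμ : UniformMargins μ) (k : Fin 2) {s : Set ℝ}
    (hs : MeasurableSet s) : μ {u | u k ∈ s} = volume (s ∩ Icc (0 : ℝ) 1) := by
  rw [← Measure.restrict_apply hs, ← hμ k, Measure.map_apply (by fun_prop) hs]
  rfl

omit [IsProbabilityMeasure μ] in
theorem UniformMargins.measureReal_le (hμ : UniformMargins μ) (k : Fin 2) {t : ℝ}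
    (ht : t ∈ Icc (0 : ℝ) 1) : μ.real {u | u k ≤ t} = t := by
  have : μ {u | u k ≤ t} = volume (Iic t ∩ Icc (0 : ℝ) 1) :=
    hμ.measure_preimage k measurableSet_Iic
  have h2 : Iic t ∩ Icc (0 : ℝ) 1 = Icc 0 t := by
    ext s; simp only [mem_inter_iff, mem_Iic, mem_Icc]
    constructor
    · rintro ⟨a, b, c⟩; exact ⟨b, a⟩
    · rintro ⟨a, b⟩; exact ⟨b, a, b.trans ht.2⟩
  rw [measureReal_def, this, h2, Real.volume_Icc, sub_zero, ENNReal.toReal_ofReal ht.1]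

omit [IsProbabilityMeasure μ] in
theorem UniformMargins.measure_eq (hμ : UniformMargins μ) (k : Fin 2) (t : ℝ) :
    μ {u | u k = t} = 0 :=
  (hμ.measure_preimage k (measurableSet_singleton t)).trans
    (measure_mono_null inter_subset_left Real.volume_singleton)

omit [IsProbabilityMeasure μ] in
theorem UniformMargins.nullSingletonClass (hμ : UniformMargins μ) : NullSingletonClass μ :=
  ⟨fun u => measure_mono_null (fun v hv => by
    rw [mem_singleton_iff.1 hv]; exact rfl) (hμ.measure_eq 0 (u 0))⟩

/-- The difference of two half-line indicators of a coordinate. -/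
noncomputable def stepDiff (k : Fin 2) (c t : ℝ) (y : Plane) : ℝ :=
  (if y k ≤ t then 1 else 0) - if y k ≤ c then 1 else 0

theorem measurable_stepDiff (k : Fin 2) (c t : ℝ) : Measurable (stepDiff k c t) :=
  (Measurable.ite (measurableSet_le (by fun_prop) measurable_const) measurable_const
    measurable_const).sub (Measurable.ite (measurableSet_le (by fun_prop) measurable_const)
    measurable_const measurable_const)

theorem abs_stepDiff_le (k : Fin 2) (c t : ℝ) (y : Plane) : |stepDiff k c t y| ≤ 1 := by
  unfold stepDiff; split_ifs <;> norm_num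

theorem UniformMargins.integral_stepDiff (hμ : UniformMargins μ) (k : Fin 2) {c t : ℝ}
    (hc : c ∈ Icc (0 : ℝ) 1) (ht : t ∈ Icc (0 : ℝ) 1) : ∫ y, stepDiff k c t y ∂μ = t - c := by
  have hm : ∀ t : ℝ, MeasurableSet {y : Plane | y k ≤ t} := fun t =>
    measurableSet_le (by fun_prop) measurable_const
  have h : ∀ y, stepDiff k c t y = {y : Plane | y k ≤ t}.indicator (1 : Plane → ℝ) y -
      {y : Plane | y k ≤ c}.indicator (1 : Plane → ℝ) y := fun y => by
    simp [stepDiff, indicator_apply]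
  simp only [h]
  have hi : ∀ t : ℝ, Integrable ({y : Plane | y k ≤ t}.indicator (1 : Plane → ℝ)) μ := fun t =>
    (integrable_const (1 : ℝ)).indicator (hm t)
  rw [integral_sub (hi t) (hi c), integral_indicator_one (hm t),
    integral_indicator_one (hm c), hμ.measureReal_le k ht, hμ.measureReal_le k hc]

theorem UniformMargins.integral_stepDiff_sq (hμ : UniformMargins μ) (k : Fin 2) {c t : ℝ}
    (hc : c ∈ Icc (0 : ℝ) 1) (ht : t ∈ Icc (0 : ℝ) 1) :
    ∫ y, stepDiff k c t y ^ 2 ∂μ = |t - c| := by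
  rcases le_total c t with h | h
  · have : ∀ y, stepDiff k c t y ^ 2 = stepDiff k c t y := fun y => by
      unfold stepDiff
      split_ifs with h1 h2 h2 <;> norm_num
      exact absurd (h2.trans h) h1
    simp only [this, hμ.integral_stepDiff k hc ht]
    rw [abs_of_nonneg (sub_nonneg.2 h)]
  · have : ∀ y, stepDiff k c t y ^ 2 = - stepDiff k c t y := fun y => by
      unfold stepDiff
      split_ifs with h1 h2 h2 <;> norm_num
      exact absurd (h1.trans h) h2
    simp only [this, integral_neg, hμ.integral_stepDiff k hc ht]
    rw [abs_of_nonpos (sub_nonpos.2 h)]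

/-- With the `i`-th term set apart, the remaining sum is i.i.d. once `x i` is fixed. The sample has
`n + 1` points, so the normalisation is `n + 2`. -/
theorem empiricalCdf_increment_eq {n : ℕ} (x : Fin (n + 1) → Plane) (i : Fin (n + 1)) (k : Fin 2)
    (t : ℝ) : empiricalCdf (fun j => x j k) t - empiricalCdf (fun j => x j k) (x i k) =
      (stepDiff k (x i k) t (x i) + ∑ j, stepDiff k (x i k) t (x (i.succAbove j))) /
        ((n : ℝ) + 2) := by
  rw [empiricalCdf_eq, empiricalCdf_eq, ← sub_div, ← Finset.sum_sub_distrib,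
    Fin.sum_univ_succAbove _ i]
  push_cast
  rw [add_assoc, one_add_one_eq_two]
  rfl

theorem measurableSet_increment {n : ℕ} (k : Fin 2) (l : ℤ) (h : ℝ) :
    MeasurableSet {z : Plane × (Fin n → Plane) | h < |(stepDiff k (z.1 k) (z.1 k + l * h) z.1 +
      ∑ j, stepDiff k (z.1 k) (z.1 k + l * h) (z.2 j)) / ((n : ℝ) + 2) - l * h|} := by
  have h1 : Measurable fun z : Plane × (Fin n → Plane) =>
      stepDiff k (z.1 k) (z.1 k + l * h) z.1 :=
    (Measurable.ite (measurableSet_le (by fun_prop) (by fun_prop)) measurable_const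
      measurable_const).sub (Measurable.ite (measurableSet_le (by fun_prop) (by fun_prop))
      measurable_const measurable_const)
  have h2 : ∀ j, Measurable fun z : Plane × (Fin n → Plane) =>
      stepDiff k (z.1 k) (z.1 k + l * h) (z.2 j) := fun j =>
    (Measurable.ite (measurableSet_le (by fun_prop) (by fun_prop)) measurable_const
      measurable_const).sub (Measurable.ite (measurableSet_le (by fun_prop) (by fun_prop))
      measurable_const measurable_const)
  have h3 : Measurable fun z : Plane × (Fin n → Plane) =>
      ∑ j, stepDiff k (z.1 k) (z.1 k + l * h) (z.2 j) :=
    Finset.measurable_fun_sum _ fun j _ => h2 j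
  exact measurableSet_lt measurable_const
    (continuous_abs.measurable.comp (((h1.add h3).div_const _).sub_const _))

variable (μ) in
/-- The conditional probability, given that the distinguished sample point is `u`, of an irregular
increment at the grid point `l`. -/
noncomputable def incrementProb (n : ℕ) (k : Fin 2) (l : ℤ) (h : ℝ) (u : Plane) : ℝ :=
  (sampleLaw μ n).real {y | h < |(stepDiff k (u k) (u k + l * h) u +
      ∑ j, stepDiff k (u k) (u k + l * h) (y j)) / ((n : ℝ) + 2) - l * h|}

theorem measurable_incrementProb (n : ℕ) (k : Fin 2) (l : ℤ) (h : ℝ) :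
    Measurable (incrementProb μ n k l h) :=
  (measurable_measure_prodMk_left (ν := sampleLaw μ n)
    (measurableSet_increment k l h)).ennreal_toReal

theorem increment_preimage {n : ℕ} (i : Fin (n + 1)) (k : Fin 2) (l : ℤ) (h : ℝ) :
    {x : Fin (n + 1) → Plane | h < |empiricalCdf (fun j => x j k) (x i k + l * h)
      - empiricalCdf (fun j => x j k) (x i k) - l * h|} =
    {x | (x i, fun j => x (i.succAbove j)) ∈ {z : Plane × (Fin n → Plane) |
      h < |(stepDiff k (z.1 k) (z.1 k + l * h) z.1 +
      ∑ j, stepDiff k (z.1 k) (z.1 k + l * h) (z.2 j)) / ((n : ℝ) + 2) - l * h|}} := by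
  ext x
  simp only [mem_ofPred_eq, empiricalCdf_increment_eq]

theorem measurableSet_irregular {n : ℕ} (i : Fin (n + 1)) (h : ℝ) (M : ℕ) :
    MeasurableSet (irregular i h M) := by
  refine MeasurableSet.iUnion fun k => Finset.measurableSet_biUnion _ fun l _ => ?_
  rw [increment_preimage]
  exact (show Measurable fun x : Fin (n + 1) → Plane => (x i, fun j => x (i.succAbove j)) by
    fun_prop) (measurableSet_increment k l h)

theorem sampleLaw_irregular_le {n : ℕ} (i : Fin (n + 1)) (h : ℝ) (M : ℕ) :
    (sampleLaw μ (n + 1)).real (irregular i h M) ≤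
      ∑ k : Fin 2, ∑ l ∈ Finset.Icc (-(M : ℤ)) M, ∫ u, incrementProb μ n k l h u ∂μ := by
  unfold irregular
  refine (measureReal_iUnion_fintype_le _).trans (Finset.sum_le_sum fun k _ => ?_)
  refine (measureReal_biUnion_finset_le _ _).trans (Finset.sum_le_sum fun l _ => le_of_eq ?_)
  rw [increment_preimage]
  exact sampleLaw_cond_real μ i (measurableSet_increment k l h)

/-- Chebyshev with second moment `|l| h`. In the condition on `c`, the `1` pays for the point's own
term and `2 |l| h` for centring with `n + 2` instead of `n`. -/
theorem UniformMargins.incrementProb_le (hμ : UniformMargins μ) {n : ℕ} {k : Fin 2} {l : ℤ} {h : ℝ}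
    {u : Plane} (hu : u k ∈ Icc (0 : ℝ) 1) (hul : u k + l * h ∈ Icc (0 : ℝ) 1) (hh : 0 < h)
    {c : ℝ} (hc : 0 < c) (hcn : c ≤ ((n : ℝ) + 2) * h - 2 * (|(l : ℝ)| * h) - 1) :
    incrementProb μ n k l h u ≤ n * (|(l : ℝ)| * h) / c ^ 2 := by
  have hmem : MemLp (stepDiff k (u k) (u k + l * h)) 2 μ :=
    MemLp.of_bound (measurable_stepDiff _ _ _).aestronglyMeasurable 1
      (ae_of_all _ fun y => by rw [Real.norm_eq_abs]; exact abs_stepDiff_le _ _ _ y)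
  have hC := sampleLaw_sum_concentration μ (n := n) hmem hc
  rw [hμ.integral_stepDiff_sq k hu hul, hμ.integral_stepDiff k hu hul] at hC
  have hlh : |u k + l * h - u k| = |(l : ℝ)| * h := by
    rw [add_sub_cancel_left, abs_mul, abs_of_pos hh]
  rw [hlh] at hC
  refine le_trans (measureReal_mono fun y hy => ?_) hC
  simp only [mem_ofPred_eq] at hy ⊢
  rw [add_sub_cancel_left]
  have hn : (0 : ℝ) < (n : ℝ) + 2 := by positivity
  set T := ∑ j, stepDiff k (u k) (u k + l * h) (y j)
  set e := stepDiff k (u k) (u k + l * h) u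
  have he : |e| ≤ 1 := abs_stepDiff_le _ _ _ _
  have h1 : ((n : ℝ) + 2) * h < |e + T - ((n : ℝ) + 2) * (l * h)| := by
    have := mul_lt_mul_of_pos_left hy hn
    rwa [← abs_of_pos hn, ← abs_mul, abs_of_pos hn, mul_sub, mul_div_cancel₀ _ hn.ne'] at this
  have h2 : |e + T - ((n : ℝ) + 2) * (l * h)| ≤ |T - n * (l * h)| + |e| + 2 * (|(l : ℝ)| * h) := by
    have : e + T - ((n : ℝ) + 2) * (l * h) = (T - n * (l * h)) + e + -(2 * (l * h)) := by ring
    rw [this]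
    refine (abs_add_three _ _ _).trans (le_of_eq ?_)
    rw [abs_neg, abs_mul, abs_two, abs_mul (l : ℝ) h, abs_of_pos hh]
  linarith

theorem UniformMargins.tendsto_incrementProb (hμ : UniformMargins μ) {δ : ℝ} (hδ : 0 < δ)
    (k : Fin 2) (l : ℤ) {u : Plane} (hu : u k ∈ Ioo (0 : ℝ) 1) :
    Tendsto (fun n : ℕ => incrementProb μ n k l (δ / √(n : ℝ)) u) atTop (𝓝 0) := by
  have hsqrt : Tendsto (fun n : ℕ => √(n : ℝ)) atTop atTop :=
    Real.tendsto_sqrt_atTop.comp tendsto_natCast_atTop_atTop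
  have hh : Tendsto (fun n : ℕ => δ / √(n : ℝ)) atTop (𝓝 0) :=
    Tendsto.div_atTop tendsto_const_nhds hsqrt
  have hlim : Tendsto (fun n : ℕ => (4 * |(l : ℝ)| / δ ^ 2) * (δ / √(n : ℝ))) atTop (𝓝 0) := by
    simpa using hh.const_mul (4 * |(l : ℝ)| / δ ^ 2)
  have hin : ∀ᶠ n : ℕ in atTop, u k + l * (δ / √(n : ℝ)) ∈ Ioo (0 : ℝ) 1 := by
    have : Tendsto (fun n : ℕ => u k + l * (δ / √(n : ℝ))) atTop (𝓝 (u k)) := by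
      simpa using (hh.const_mul (l : ℝ)).const_add (u k)
    exact this.eventually (isOpen_Ioo.mem_nhds hu)
  refine tendsto_of_tendsto_of_tendsto_of_le_of_le' tendsto_const_nhds hlim
    (Eventually.of_forall fun n => measureReal_nonneg) ?_
  filter_upwards [hin, hsqrt.eventually_ge_atTop (2 * (2 * |(l : ℝ)| * δ + 1) / δ),
    hsqrt.eventually_ge_atTop 1] with n hn1 hn2 hn3
  have hs : 0 < √(n : ℝ) := by linarith
  have hnn : (n : ℝ) = √(n : ℝ) ^ 2 := (Real.sq_sqrt (Nat.cast_nonneg n)).symm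
  have hpos : 0 < δ / √(n : ℝ) := by positivity
  -- `c` is half of the leading term `n h = δ √n`; for large `n` the other half absorbs the bounded
  -- corrections.
  have hle := hμ.incrementProb_le (n := n) (Ioo_subset_Icc_self hu) (Ioo_subset_Icc_self hn1) hpos
    (c := δ * √(n : ℝ) / 2) (by positivity) (by
      have e1 : (n : ℝ) * (δ / √(n : ℝ)) = δ * √(n : ℝ) := by
        nth_rewrite 1 [hnn]; field_simp
      have e2 : δ / √(n : ℝ) ≤ δ := div_le_self hδ.le hn3
      have e3 : |(l : ℝ)| * (δ / √(n : ℝ)) ≤ |(l : ℝ)| * δ := by gcongr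
      rw [div_le_iff₀ hδ] at hn2
      nlinarith)
  refine hle.trans (le_of_eq ?_)
  nth_rewrite 1 [hnn]
  field_simp
  ring

theorem UniformMargins.tendsto_integral_incrementProb (hμ : UniformMargins μ) {δ : ℝ} (hδ : 0 < δ)
    (k : Fin 2) (l : ℤ) :
    Tendsto (fun n : ℕ => ∫ u, incrementProb μ n k l (δ / √(n : ℝ)) u ∂μ) atTop (𝓝 0) := by
  have hae : ∀ᵐ u ∂μ, u k ∈ Ioo (0 : ℝ) 1 := by
    change μ {u : Plane | u k ∈ (Ioo (0 : ℝ) 1)ᶜ} = 0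
    rw [hμ.measure_preimage k measurableSet_Ioo.compl]
    refine measure_mono_null (t := {0, 1}) ?_ ((Set.toFinite _).measure_zero _)
    rintro t ⟨h1, h2, h3⟩
    simp only [mem_compl_iff, mem_Ioo, not_and, not_lt] at h1
    rcases h2.eq_or_lt with h | h
    · exact Or.inl h.symm
    · exact Or.inr (le_antisymm h3 (h1 h))
  have := tendsto_integral_of_dominated_convergence (μ := μ) (fun _ => (1 : ℝ))
    (F := fun (n : ℕ) u => incrementProb μ n k l (δ / √(n : ℝ)) u) (f := fun _ => 0)
    (fun n => (measurable_incrementProb n k l _).aestronglyMeasurable) (integrable_const _)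
    (fun n => ae_of_all _ fun u => by
      rw [Real.norm_eq_abs, incrementProb, abs_of_nonneg measureReal_nonneg]
      exact measureReal_le_one)
    (hae.mono fun u hu => hμ.tendsto_incrementProb hδ k l hu)
  simpa using this

/-- Markov's inequality for the fraction of events that occur. -/
theorem measure_frequency_ge_le {Ω : Type*} [MeasurableSpace Ω] (Q : Measure Ω)
    [IsProbabilityMeasure Q] {n : ℕ} {B : Fin (n + 1) → Set Ω} (hB : ∀ i, MeasurableSet (B i))
    {β ε : ℝ} (hβ : ∀ i, Q.real (B i) ≤ β) (hε : 0 < ε) :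
    Q.real {x | ε ≤ (∑ i, (B i).indicator (1 : Ω → ℝ) x) / ((n : ℝ) + 1)} ≤ β / ε := by
  have hn1 : (0 : ℝ) < (n : ℝ) + 1 := by positivity
  have hi : ∀ i, Integrable ((B i).indicator (1 : Ω → ℝ)) Q := fun i =>
    (integrable_const (1 : ℝ)).indicator (hB i)
  have hmarkov := mul_meas_ge_le_integral_of_nonneg (μ := Q)
    (f := fun x => (∑ i, (B i).indicator (1 : Ω → ℝ) x) / ((n : ℝ) + 1))
    (ae_of_all _ fun x => div_nonneg
      (Finset.sum_nonneg fun i _ => indicator_nonneg (fun _ _ => zero_le_one) x) hn1.le)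
    ((integrable_finsetSum _ fun i _ => hi i).div_const _) ε
  rw [le_div_iff₀ hε, mul_comm]
  refine hmarkov.trans ?_
  rw [integral_div, integral_finsetSum _ fun i _ => hi i]
  simp only [integral_indicator_one (hB _)]
  rw [div_le_iff₀ hn1]
  refine (Finset.sum_le_sum fun i _ => hβ i).trans (le_of_eq ?_)
  simp only [Finset.sum_const, Finset.card_univ, Fintype.card_fin, nsmul_eq_mul]
  push_cast
  ring

theorem abs_min_mul_nnDist_rankTransform_sub_le {n : ℕ} (hn : 1 ≤ n) {δ K : ℝ} (hδ : 0 < δ)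
    (hK : 0 < K) {M : ℕ} (hM : K ≤ M * δ - δ) (x : Fin (n + 1) → Plane) (i : Fin (n + 1)) :
    |min (√(n : ℝ) * nnDist (rankTransform x) i) K - min (√(n : ℝ) * nnDist x i) K| ≤
      4 * δ + K * (irregular i (δ / √(n : ℝ)) M).indicator (fun _ => (1 : ℝ)) x := by
  have hs : 0 < √(n : ℝ) := Real.sqrt_pos.2 (by exact_mod_cast hn)
  have hscale : ∀ a : ℝ, min (√(n : ℝ) * a) K = √(n : ℝ) * min a (K / √(n : ℝ)) := fun a => by
    rw [mul_min_of_nonneg _ _ hs.le, mul_div_cancel₀ _ hs.ne']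
  by_cases hx : x ∈ irregular i (δ / √(n : ℝ)) M
  · rw [indicator_of_mem hx, mul_one]
    have a1 : 0 ≤ min (√(n : ℝ) * nnDist (rankTransform x) i) K :=
      le_min (mul_nonneg hs.le (nnDist_nonneg _ _)) hK.le
    have a2 : 0 ≤ min (√(n : ℝ) * nnDist x i) K :=
      le_min (mul_nonneg hs.le (nnDist_nonneg _ _)) hK.le
    have a3 := min_le_right (√(n : ℝ) * nnDist (rankTransform x) i) K
    have a4 := min_le_right (√(n : ℝ) * nnDist x i) K
    rw [abs_le]; constructor <;> linarith
  · rw [indicator_of_notMem hx, mul_zero, add_zero, hscale, hscale, ← mul_sub, abs_mul,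
      abs_of_pos hs]
    have hKM : K / √(n : ℝ) ≤ M * (δ / √(n : ℝ)) - δ / √(n : ℝ) := by
      rw [← mul_div_assoc, ← sub_div]
      exact div_le_div_of_nonneg_right hM hs.le
    have := abs_min_nnDist_rankTransform_sub_le hn (div_pos hδ hs) hKM hx
    calc _ ≤ √(n : ℝ) * (4 * (δ / √(n : ℝ))) := mul_le_mul_of_nonneg_left this hs.le
      _ = 4 * δ := by field_simp

theorem UniformMargins.tendsto_average_rankTransform (hμ : UniformMargins μ) {K ε : ℝ} (hK : 0 < K)
    (hε : 0 < ε) :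
    Tendsto (fun n : ℕ => (sampleLaw μ (n + 1)).real {x | ε ≤
      (∑ i, |min (√(n : ℝ) * nnDist (rankTransform x) i) K - min (√(n : ℝ) * nnDist x i) K|) /
        ((n : ℝ) + 1)}) atTop (𝓝 0) := by
  -- With mesh parameter `ε / 8` the regular points contribute at most `4 · ε / 8 = ε / 2`, so the
  -- irregular ones, each costing at most `K`, must have frequency at least `ε / (2K)`.
  obtain ⟨M, hM⟩ := exists_nat_ge (K / (ε / 8) + 1)
  have hMδ : K ≤ M * (ε / 8) - ε / 8 := by
    have : K / (ε / 8) * (ε / 8) = K := by field_simp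
    nlinarith
  have hβ : Tendsto (fun n : ℕ => (∑ k : Fin 2, ∑ l ∈ Finset.Icc (-(M : ℤ)) M,
      ∫ u, incrementProb μ n k l (ε / 8 / √(n : ℝ)) u ∂μ) / (ε / (2 * K))) atTop (𝓝 0) := by
    have := (tendsto_finsetSum Finset.univ fun (k : Fin 2) _ => tendsto_finsetSum
      (Finset.Icc (-(M : ℤ)) M) fun l _ =>
        hμ.tendsto_integral_incrementProb (show 0 < ε / 8 by positivity) k l).div_const
      (ε / (2 * K))
    simpa using this
  refine tendsto_of_tendsto_of_tendsto_of_le_of_le' tendsto_const_nhds hβ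
    (Eventually.of_forall fun n => measureReal_nonneg) ?_
  filter_upwards [eventually_ge_atTop 1] with n hn
  have hn1 : (0 : ℝ) < (n : ℝ) + 1 := by positivity
  refine (measureReal_mono fun x hx => ?_).trans (measure_frequency_ge_le (sampleLaw μ (n + 1))
    (fun i => measurableSet_irregular i (ε / 8 / √(n : ℝ)) M)
    (fun i => sampleLaw_irregular_le i _ M) (by positivity))
  simp only [mem_ofPred_eq] at hx ⊢
  rw [le_div_iff₀ hn1] at hx ⊢
  have := hx.trans (Finset.sum_le_sum fun i _ =>
    abs_min_mul_nnDist_rankTransform_sub_le hn (show 0 < ε / 8 by positivity) hK hMδ x i)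
  rw [Finset.sum_add_distrib, ← Finset.mul_sum Finset.univ _ K] at this
  simp only [Finset.sum_const, Finset.card_univ, Fintype.card_fin, nsmul_eq_mul] at this
  push_cast at this
  rw [div_mul_eq_mul_div, div_le_iff₀ (by positivity)]
  change _ ≤ (∑ i, (irregular i (ε / 8 / √(n : ℝ)) M).indicator (fun _ => (1 : ℝ)) x) * (2 * K)
  linarith

end Irregular

/-! ### A packing bound -/

theorem abs_coord_sub_le_of_mem_unitSquare {a b : Plane} (ha : a ∈ unitSquare) (hb : b ∈ unitSquare)
    (k : Fin 2) : |(a - b) k| ≤ 1 := by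
  simp only [PiLp.sub_apply]
  have h1 := ha k
  have h2 := hb k
  rw [abs_le]
  constructor <;> linarith [h1.1, h1.2, h2.1, h2.2]

/-- Balls of half the nearest-neighbour distance are disjoint. Centres have norm at most `2` and
radii are at most `1`, so all lie in a ball of radius `3`; comparing areas gives `4 · 9`. -/
theorem sum_nnDist_sq_le {n : ℕ} (hn : 1 ≤ n) {z : Fin (n + 1) → Plane}
    (hz : ∀ i, z i ∈ unitSquare) : ∑ i, nnDist z i ^ 2 ≤ 36 := by
  have hdisj : Pairwise fun i j => Disjoint (ball (z i) (nnDist z i / 2))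
      (ball (z j) (nnDist z j / 2)) := fun i j hij => by
    refine ball_disjoint_ball ?_
    have h1 := nnDist_le z hij.symm
    have h2 := nnDist_le z hij
    rw [← dist_eq_norm] at h1 h2
    rw [dist_comm] at h1
    linarith
  have hsub : (⋃ i, ball (z i) (nnDist z i / 2)) ⊆ ball (0 : Plane) 3 := by
    refine iUnion_subset fun i => ball_subset_ball' ?_
    obtain ⟨j, -, hj⟩ := exists_nnDist_eq hn z i
    have h1 : nnDist z i ≤ 2 := by
      rw [← hj]
      refine (Plane.norm_le_add _).trans ?_
      linarith [abs_coord_sub_le_of_mem_unitSquare (hz j) (hz i) 0,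
        abs_coord_sub_le_of_mem_unitSquare (hz j) (hz i) 1]
    have h2 : dist (z i) 0 ≤ 2 := by
      rw [dist_zero_right]
      refine (Plane.norm_le_add _).trans ?_
      have h0 := hz i 0
      have h1 := hz i 1
      rw [abs_of_nonneg h0.1, abs_of_nonneg h1.1]
      linarith [h0.2, h1.2]
    linarith
  have hvol : ∀ (a : Plane) {r : ℝ}, 0 ≤ r → volume (ball a r) = ENNReal.ofReal (r ^ 2 * Real.pi) :=
    fun a r hr => by
      rw [EuclideanSpace.volume_ball_fin_two, ← ENNReal.ofReal_pow hr,
        ← ENNReal.ofReal_mul (by positivity)]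
  have h := measure_mono (μ := (volume : Measure Plane)) hsub
  rw [measure_iUnion hdisj fun _ => measurableSet_ball, tsum_fintype, hvol 0 (by norm_num)] at h
  simp only [fun i => hvol (z i) (div_nonneg (nnDist_nonneg z i) zero_le_two)] at h
  rw [← ENNReal.ofReal_sum_of_nonneg fun i _ => by positivity,
    ENNReal.ofReal_le_ofReal_iff (by positivity), ← Finset.sum_mul] at h
  have h' := le_of_mul_le_mul_right h Real.pi_pos
  simp only [div_pow, ← Finset.sum_div] at h'
  linarith

/-- Since `w - min w K ≤ w² / K`, the packing bound controls the truncation error deterministically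
and uniformly in `n`. -/
theorem abs_average_sub_average_min_le {n : ℕ} (hn : 1 ≤ n) {z : Fin (n + 1) → Plane}
    (hz : ∀ i, z i ∈ unitSquare) {K : ℝ} (hK : 0 < K) :
    |√(n : ℝ) * (∑ i, nnDist z i) / ((n : ℝ) + 1) -
      (∑ i, min (√(n : ℝ) * nnDist z i) K) / ((n : ℝ) + 1)| ≤ 36 / K := by
  have hterm : ∀ w : ℝ, 0 ≤ w → |w - min w K| ≤ w ^ 2 / K := fun w hw => by
    rcases le_total w K with h | h
    · rw [min_eq_left h, sub_self, abs_zero]; positivity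
    · rw [min_eq_right h, abs_of_nonneg (sub_nonneg.2 h), le_div_iff₀ hK]
      nlinarith
  have hn1 : (0 : ℝ) < (n : ℝ) + 1 := by positivity
  rw [← sub_div, abs_div, abs_of_pos hn1, div_le_iff₀ hn1, Finset.mul_sum, ← Finset.sum_sub_distrib]
  calc _ ≤ ∑ i, |√(n : ℝ) * nnDist z i - min (√(n : ℝ) * nnDist z i) K| :=
        Finset.abs_sum_le_sum_abs _ _
    _ ≤ ∑ i, (√(n : ℝ) * nnDist z i) ^ 2 / K := Finset.sum_le_sum fun i _ =>
        hterm _ (mul_nonneg (Real.sqrt_nonneg _) (nnDist_nonneg z i))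
    _ = n * (∑ i, nnDist z i ^ 2) / K := by
        rw [← Finset.sum_div, Finset.mul_sum]
        simp only [mul_pow, Real.sq_sqrt (Nat.cast_nonneg n)]
    _ ≤ ((n : ℝ) + 1) * 36 / K := by
        have := sum_nnDist_sq_le hn hz
        have h0 : (0 : ℝ) ≤ n := Nat.cast_nonneg n
        gcongr
        linarith
    _ = 36 / K * ((n : ℝ) + 1) := by ring

/-! ### Discretisation of a truncated average -/

/-- A discrete layer-cake formula: `δ` times the number of levels below `x`. The first clause serves
the induction. -/
theorem sum_indicator_grid {x δ : ℝ} (hδ : 0 < δ) (m : ℕ) :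
    (m * δ < x → ∑ k ∈ Finset.range m, (if (k + 1 : ℝ) * δ < x then δ else 0) = m * δ) ∧
      (0 ≤ x → |min x (m * δ) - ∑ k ∈ Finset.range m, (if (k + 1 : ℝ) * δ < x then δ else 0)| ≤ δ) := by
  induction m with
  | zero => 
    refine ⟨by simp, fun hx => ?_⟩
    simp [hx, hδ.le]
  | succ m ih =>
    obtain ⟨h1, h2⟩ := ih
    rw [Finset.sum_range_succ]
    push_cast
    constructor
    · intro h
      rw [if_pos h, h1 (by nlinarith)]
      ring
    · intro hx
      split_ifs with h
      · rw [h1 (by nlinarith), min_eq_right h.le]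
        ring_nf
        simp [hδ.le]
      · rw [add_zero]
        push Not at h
        rw [min_eq_left h]
        rcases lt_or_ge (m * δ) x with h3 | h3
        · rw [h1 h3, abs_of_nonneg (by linarith)]
          linarith
        · have := h2 hx
          rwa [min_eq_left h3] at this

theorem abs_average_min_sub_sum_frequency_le {n : ℕ} (hn : 1 ≤ n) {δ : ℝ} (hδ : 0 < δ) (m : ℕ)
    (x : Fin (n + 1) → Plane) :
    |(∑ i, min (√(n : ℝ) * nnDist x i) (m * δ)) / ((n : ℝ) + 1) - ∑ k ∈ Finset.range m,
      δ * ((∑ i, (isolated i ((k + 1) * δ / √(n : ℝ))).indicator 1 x) / ((n : ℝ) + 1))| ≤ δ := by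
  have hn1 : (0 : ℝ) < (n : ℝ) + 1 := by positivity
  have hs : 0 < √(n : ℝ) := Real.sqrt_pos.2 (by exact_mod_cast hn)
  have hswap : ∑ k ∈ Finset.range m,
      δ * ((∑ i, (isolated i ((k + 1) * δ / √(n : ℝ))).indicator (1 : (Fin (n + 1) → Plane) → ℝ) x) / ((n : ℝ) + 1)) =
      (∑ i, ∑ k ∈ Finset.range m, (if (k + 1 : ℝ) * δ < √(n : ℝ) * nnDist x i then δ else 0)) /
        ((n : ℝ) + 1) := by
    rw [Finset.sum_comm, Finset.sum_div]
    refine Finset.sum_congr rfl fun k _ => ?_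
    rw [← mul_div_assoc, Finset.mul_sum]
    congr 1
    refine Finset.sum_congr rfl fun i _ => ?_
    have : x ∈ isolated i ((k + 1) * δ / √(n : ℝ)) ↔ (k + 1 : ℝ) * δ < √(n : ℝ) * nnDist x i := by
      rw [← nnDist_gt_iff_mem_isolated hn, div_lt_iff₀ hs, mul_comm (nnDist x i)]
    split_ifs with h
    · rw [indicator_of_mem (this.2 h), Pi.one_apply, mul_one]
    · rw [indicator_of_notMem fun hx => h (this.1 hx), mul_zero]
  rw [hswap, ← sub_div, ← Finset.sum_sub_distrib, abs_div, abs_of_pos hn1, div_le_iff₀ hn1]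
  calc _ ≤ ∑ i : Fin (n + 1), δ := (Finset.abs_sum_le_sum_abs _ _).trans
        (Finset.sum_le_sum fun i _ => (sum_indicator_grid hδ m).2
          (mul_nonneg hs.le (nnDist_nonneg x i)))
    _ = _ := by simp; ring

/-! ### The limit of the discretised means -/

/-- The Riemann sum, with `m` steps of length `δ`, of `s ↦ exp (-π s² κ)`. -/
noncomputable def gaussSum (δ : ℝ) (m : ℕ) (κ : ℝ≥0∞) : ℝ :=
  ∑ k ∈ Finset.range m, δ * expNeg (ENNReal.ofReal (Real.pi * ((k + 1) * δ) ^ 2) * κ)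

theorem measurable_gaussSum (δ : ℝ) (m : ℕ) : Measurable (gaussSum δ m) :=
  Finset.measurable_fun_sum _ fun _ _ =>
    (measurable_expNeg.comp (measurable_const.mul measurable_id)).const_mul δ

theorem gaussSum_nonneg {δ : ℝ} (hδ : 0 < δ) (m : ℕ) (κ : ℝ≥0∞) : 0 ≤ gaussSum δ m κ :=
  Finset.sum_nonneg fun _ _ => mul_nonneg hδ.le (expNeg_nonneg _)

/-- The nodes `(k + 1) δ` avoid `0`, where the convention `0 * ∞ = 0` would contribute `exp 0 = 1`.
-/
theorem gaussSum_top {δ : ℝ} (hδ : 0 < δ) (m : ℕ) : gaussSum δ m ∞ = 0 := by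
  refine Finset.sum_eq_zero fun k _ => ?_
  rw [ENNReal.mul_top]
  · simp [expNeg]
  · simp only [ne_eq, ENNReal.ofReal_eq_zero, not_le]; positivity

theorem gaussSum_of_ne_top {δ : ℝ} (m : ℕ) {κ : ℝ≥0∞} (hκ : κ ≠ ∞) :
    gaussSum δ m κ = δ * ∑ k ∈ Finset.range m,
      Real.exp (-(Real.pi * κ.toReal) * (δ * (0 + (k + 1 : ℕ))) ^ 2) := by
  rw [Finset.mul_sum]
  refine Finset.sum_congr rfl fun k _ => ?_
  rw [expNeg, if_neg (ENNReal.mul_ne_top ENNReal.ofReal_ne_top hκ), ENNReal.toReal_mul,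
    ENNReal.toReal_ofReal (by positivity)]
  push_cast
  ring_nf

theorem antitoneOn_exp_neg_mul_sq {b δ : ℝ} (hb : 0 ≤ b) (hδ : 0 ≤ δ) (c : ℝ) :
    AntitoneOn (fun t : ℝ => Real.exp (-b * (δ * t) ^ 2)) (Icc 0 c) := by
  intro s hs t ht hst
  have : (δ * s) ^ 2 ≤ (δ * t) ^ 2 :=
    pow_le_pow_left₀ (mul_nonneg hδ hs.1) (mul_le_mul_of_nonneg_left hst hδ) 2
  exact Real.exp_le_exp.2 (by nlinarith)

theorem mul_integral_exp_neg_mul_sq {b δ : ℝ} (m : ℕ) :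
    δ * ∫ t in (0 : ℝ)..0 + m, Real.exp (-b * (δ * t) ^ 2) =
      ∫ t in (0 : ℝ)..m * δ, Real.exp (-b * t ^ 2) := by
  have := intervalIntegral.smul_integral_comp_mul_left (a := 0) (b := (m : ℝ))
    (fun t => Real.exp (-b * t ^ 2)) δ
  rw [zero_add, ← smul_eq_mul, this, mul_zero, mul_comm]

theorem gaussSum_le_integral {δ : ℝ} (hδ : 0 < δ) (m : ℕ) {κ : ℝ≥0∞} (hκ : κ ≠ ∞) :
    gaussSum δ m κ ≤ ∫ t in (0 : ℝ)..m * δ, Real.exp (-(Real.pi * κ.toReal) * t ^ 2) := by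
  have hb : 0 ≤ Real.pi * κ.toReal := by positivity
  rw [gaussSum_of_ne_top m hκ, ← mul_integral_exp_neg_mul_sq]
  have := AntitoneOn.sum_le_integral (x₀ := 0) (a := m)
    (antitoneOn_exp_neg_mul_sq hb hδ.le _)
  exact mul_le_mul_of_nonneg_left this hδ.le

theorem integral_le_gaussSum_add {δ : ℝ} (hδ : 0 < δ) (m : ℕ) {κ : ℝ≥0∞} (hκ : κ ≠ ∞) :
    ∫ t in (0 : ℝ)..m * δ, Real.exp (-(Real.pi * κ.toReal) * t ^ 2) ≤ gaussSum δ m κ + δ := by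
  have hb : 0 ≤ Real.pi * κ.toReal := by positivity
  rw [gaussSum_of_ne_top m hκ, ← mul_integral_exp_neg_mul_sq]
  have h := AntitoneOn.integral_le_sum (x₀ := 0) (a := m) (antitoneOn_exp_neg_mul_sq hb hδ.le _)
  have h2 : ∑ k ∈ Finset.range m, Real.exp (-(Real.pi * κ.toReal) * (δ * (0 + (k : ℝ))) ^ 2) ≤
      ∑ k ∈ Finset.range m, Real.exp (-(Real.pi * κ.toReal) * (δ * (0 + (k + 1 : ℕ))) ^ 2) + 1 := by
    -- Left- and right-endpoint sums differ only in their end terms, and the value at `0` is `1`.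
    have e := Finset.sum_range_succ' (fun k : ℕ =>
      Real.exp (-(Real.pi * κ.toReal) * (δ * (0 + (k : ℝ))) ^ 2)) m
    rw [Finset.sum_range_succ] at e
    simp only [Nat.cast_zero, add_zero, mul_zero, ne_eq, OfNat.ofNat_ne_zero, not_false_eq_true,
      zero_pow, Real.exp_zero] at e
    linarith [Real.exp_pos (-(Real.pi * κ.toReal) * (δ * (0 + (m : ℝ))) ^ 2)]
  calc _ ≤ δ * (∑ k ∈ Finset.range m,
        Real.exp (-(Real.pi * κ.toReal) * (δ * (0 + (k + 1 : ℕ))) ^ 2) + 1) :=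
        mul_le_mul_of_nonneg_left (h.trans h2) hδ.le
    _ = _ := by ring

theorem integral_Ioi_exp_neg_pi_mul_sq (κ : ℝ≥0∞) :
    ∫ t in Ioi (0 : ℝ), Real.exp (-(Real.pi * κ.toReal) * t ^ 2) = √(κ⁻¹).toReal / 2 := by
  rw [integral_gaussian_Ioi, ENNReal.toReal_inv, div_mul_cancel_left₀ Real.pi_ne_zero]

/-- The dominating function, uniform in `δ` and `m`. For `κ = 0` it fails: the sum is `m δ`, while
`toReal` sends `κ⁻¹ = ∞` to `0`. -/
theorem gaussSum_le {δ : ℝ} (hδ : 0 < δ) (m : ℕ) {κ : ℝ≥0∞} (hκ0 : κ ≠ 0) :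
    gaussSum δ m κ ≤ √(κ⁻¹).toReal / 2 := by
  by_cases hκ : κ = ∞
  · rw [hκ, gaussSum_top hδ]; simp
  have hb : 0 < Real.pi * κ.toReal := mul_pos Real.pi_pos (ENNReal.toReal_pos hκ0 hκ)
  refine (gaussSum_le_integral hδ m hκ).trans ?_
  rw [← integral_Ioi_exp_neg_pi_mul_sq, intervalIntegral.integral_of_le (by positivity)]
  exact setIntegral_mono_set (integrable_exp_neg_mul_sq hb).integrableOn
    (ae_of_all _ fun t => (Real.exp_pos _).le) (ae_of_all _ fun t ht => ht.1)

/-- The choice of parameters lets the step `1 / (j + 1)` vanish while the truncation level `m δ = j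
+ 1` tends to infinity. -/
theorem tendsto_gaussSum {κ : ℝ≥0∞} (hκ0 : κ ≠ 0) :
    Tendsto (fun j : ℕ => gaussSum (1 / ((j : ℝ) + 1)) ((j + 1) ^ 2) κ) atTop
      (𝓝 (√(κ⁻¹).toReal / 2)) := by
  by_cases hκ : κ = ∞
  · subst hκ
    simp only [fun j : ℕ => gaussSum_top (show 0 < 1 / ((j : ℝ) + 1) by positivity) ((j + 1) ^ 2)]
    simp
  have hb : 0 < Real.pi * κ.toReal := mul_pos Real.pi_pos (ENNReal.toReal_pos hκ0 hκ)
  have hK : ∀ j : ℕ, (((j + 1) ^ 2 : ℕ) : ℝ) * (1 / ((j : ℝ) + 1)) = (j : ℝ) + 1 := fun j => by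
    push_cast; field_simp
  have hlim : Tendsto (fun j : ℕ => ∫ t in (0 : ℝ)..(j : ℝ) + 1,
      Real.exp (-(Real.pi * κ.toReal) * t ^ 2)) atTop (𝓝 (√(κ⁻¹).toReal / 2)) := by
    rw [← integral_Ioi_exp_neg_pi_mul_sq]
    exact intervalIntegral_tendsto_integral_Ioi 0 (integrable_exp_neg_mul_sq hb).integrableOn
      (tendsto_atTop_add_const_right _ _ tendsto_natCast_atTop_atTop)
  have hlow := hlim.sub tendsto_one_div_add_atTop_nhds_zero_nat
  rw [sub_zero] at hlow
  refine tendsto_of_tendsto_of_tendsto_of_le_of_le hlow hlim (fun j => ?_) (fun j => ?_)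
  · have := integral_le_gaussSum_add (show 0 < 1 / ((j : ℝ) + 1) by positivity) ((j + 1) ^ 2) hκ
    rw [hK] at this
    simp only
    linarith
  · have := gaussSum_le_integral (show 0 < 1 / ((j : ℝ) + 1) by positivity) ((j + 1) ^ 2) hκ
    rwa [hK] at this

/-! ### From the local density to the Bhattacharyya coefficient -/

section Limit

variable {μ : Measure Plane}

theorem UniformMargins.measure_compl_unitSquare (hμ : UniformMargins μ) : μ unitSquareᶜ = 0 := by
  have : unitSquareᶜ ⊆ ⋃ k : Fin 2, {u : Plane | u k ∈ (Icc (0 : ℝ) 1)ᶜ} := fun u hu => by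
    simp only [unitSquare, mem_compl_iff, mem_ofPred_eq, not_forall] at hu
    exact mem_iUnion.2 hu
  refine measure_mono_null this (measure_iUnion_null fun k => ?_)
  rw [hμ.measure_preimage k measurableSet_Icc.compl, compl_inter_self, measure_empty]

theorem measurableSet_unitSquare : MeasurableSet unitSquare := by
  unfold unitSquare
  rw [ofPred_forall]
  refine MeasurableSet.iInter fun k => ?_
  exact (show Measurable fun u : Plane => u k by fun_prop) measurableSet_Icc

theorem unitSquare_subset_closedBall : unitSquare ⊆ closedBall (0 : Plane) 2 := fun u hu => by
  rw [mem_closedBall_zero_iff]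
  refine (Plane.norm_le_add _).trans ?_
  have h0 := hu 0
  have h1 := hu 1
  rw [abs_of_nonneg h0.1, abs_of_nonneg h1.1]
  linarith [h0.2, h1.2]

variable [IsProbabilityMeasure μ]

/-- Use `√x ≤ x + 1`: the derivative of Lebesgue measure has `μ`-integral at most the area of a
bounded set carrying `μ`. -/
theorem UniformMargins.integrable_sqrt_rnDeriv (hμ : UniformMargins μ) :
    Integrable (fun u => √(volume.rnDeriv μ u).toReal) μ := by
  have hr : μ.restrict unitSquare = μ :=
    Measure.restrict_eq_self_of_ae_mem (measure_eq_zero_iff_ae_notMem.1 hμ.measure_compl_unitSquare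
      |>.mono fun u hu => not_not.1 hu)
  have hfin : ∫⁻ u, volume.rnDeriv μ u ∂μ ≠ ∞ := by
    have h := Measure.setLIntegral_rnDeriv_le (μ := (volume : Measure Plane)) (ν := μ) unitSquare
    rw [hr] at h
    exact ((h.trans (measure_mono unitSquare_subset_closedBall)).trans_lt
      measure_closedBall_lt_top).ne
  have hint := integrable_toReal_of_lintegral_ne_top
    (Measure.measurable_rnDeriv _ _).aemeasurable hfin
  refine (hint.add (integrable_const (1 : ℝ))).mono'
    ((Measure.measurable_rnDeriv _ _).ennreal_toReal.sqrt).aestronglyMeasurable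
    (ae_of_all _ fun u => ?_)
  rw [Real.norm_eq_abs, abs_of_nonneg (Real.sqrt_nonneg _)]
  simp only [Pi.add_apply]
  have h0 : 0 ≤ (volume.rnDeriv μ u).toReal := ENNReal.toReal_nonneg
  refine Real.sqrt_le_iff.2 ⟨by positivity, by nlinarith⟩

/-- Split `μ` into its singular part, where the derivative of Lebesgue measure vanishes, and its
part with density `c`, where that derivative is `1/c`; there `c · c^(-1/2) = √c`. -/
theorem UniformMargins.integral_sqrt_rnDeriv (hμ : UniformMargins μ) :
    ∫ u, √(volume.rnDeriv μ u).toReal ∂μ = ∫ u in unitSquare, √(μ.rnDeriv volume u).toReal := by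
  set c := μ.rnDeriv (volume : Measure Plane) with hc
  set s := μ.singularPart (volume : Measure Plane) with hs
  set w := (volume : Measure Plane).withDensity c with hw
  have hdec : μ = s + w := μ.haveLebesgueDecomposition_add volume
  have hcm : Measurable c := Measure.measurable_rnDeriv _ _
  have hctop : ∀ᵐ u ∂(volume : Measure Plane), c u < ∞ := Measure.rnDeriv_lt_top _ _
  have hwac : w ≪ volume := withDensity_absolutelyContinuous _ _
  have hsv : s ⟂ₘ (volume : Measure Plane) := Measure.mutuallySingular_singularPart _ _
  have hsw : s ⟂ₘ w := hsv.mono_ac Measure.AbsolutelyContinuous.rfl hwac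
  have hwfin : IsFiniteMeasure w := ⟨by
    rw [hw, withDensity_apply _ MeasurableSet.univ, Measure.restrict_univ]
    exact Measure.lintegral_rnDeriv_lt_top _ _⟩
  have hgs : volume.rnDeriv μ =ᵐ[s] 0 := by
    have h1 := Measure.rnDeriv_add_right_of_mutuallySingular (μ := (volume : Measure Plane)) hsw
    rw [← hdec] at h1
    exact h1.trans ((Measure.rnDeriv_eq_zero _ _).2 hsv.symm)
  have hgw : volume.rnDeriv μ =ᵐ[w] c⁻¹ := by
    have h1 := Measure.rnDeriv_add_right_of_mutuallySingular (μ := (volume : Measure Plane)) hsw.symm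
    rw [add_comm, ← hdec] at h1
    have h2 := Measure.inv_rnDeriv hwac
    have h3 : w.rnDeriv volume =ᵐ[w] c := hwac.ae_eq (Measure.rnDeriv_withDensity _ hcm)
    filter_upwards [h1, h2, h3] with u e1 e2 e3
    rw [e1, ← e2, Pi.inv_apply, Pi.inv_apply, e3]
  have hint := hμ.integrable_sqrt_rnDeriv
  have hints : Integrable (fun u => √(volume.rnDeriv μ u).toReal) s :=
    hint.mono_measure (by rw [hdec]; exact Measure.le_add_right le_rfl)
  have hintw : Integrable (fun u => √(volume.rnDeriv μ u).toReal) w :=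
    hint.mono_measure (by rw [hdec]; exact Measure.le_add_left le_rfl)
  have hsplit : ∫ u, √(volume.rnDeriv μ u).toReal ∂μ =
      ∫ u, √(volume.rnDeriv μ u).toReal ∂s + ∫ u, √(volume.rnDeriv μ u).toReal ∂w := by
    rw [← integral_add_measure hints hintw, ← hdec]
  have h1 : ∫ u, √(volume.rnDeriv μ u).toReal ∂s = 0 := by
    rw [integral_congr_ae (g := fun _ => (0 : ℝ)) (hgs.mono fun u hu => by simp [hu]),
      integral_zero]
  have h2 : ∫ u, √(volume.rnDeriv μ u).toReal ∂w = ∫ u, √(c u).toReal := by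
    rw [integral_congr_ae (g := fun u => √((c u)⁻¹).toReal) (hgw.mono fun u hu => by simp [hu]),
      hw, integral_withDensity_eq_integral_toReal_smul hcm hctop]
    congr with u
    rw [smul_eq_mul, ENNReal.toReal_inv, Real.sqrt_inv, ← div_eq_mul_inv, Real.div_sqrt]
  rw [hsplit, h1, h2, zero_add]
  symm
  refine setIntegral_eq_integral_of_ae_compl_eq_zero ?_
  have h3 : ∫⁻ u in unitSquareᶜ, c u ≤ 0 :=
    (Measure.setLIntegral_rnDeriv_le _).trans hμ.measure_compl_unitSquare.le
  have h4 := (setLIntegral_eq_zero_iff measurableSet_unitSquare.compl hcm).1 (le_antisymm h3 bot_le)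
  filter_upwards [h4] with u hu hmem
  simp [hu hmem]

theorem sum_isolationProb_eq (δ : ℝ) (m : ℕ) :
    ∑ k ∈ Finset.range m, δ * isolationProb μ ((k + 1) * δ) =
      ∫ u, gaussSum δ m (localDensity μ u) ∂μ := by
  simp only [gaussSum]
  rw [integral_finsetSum]
  · simp only [integral_const_mul]
    rfl
  · intro k _
    refine Integrable.const_mul (Integrable.of_bound (C := 1) (measurable_expNeg.comp
      (measurable_const.mul (measurable_localDensity μ))).aestronglyMeasurable
      (ae_of_all _ fun u => ?_)) δ
    rw [Function.comp_apply, Real.norm_eq_abs, abs_of_nonneg (expNeg_nonneg _)]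
    exact expNeg_le_one _

theorem UniformMargins.tendsto_sum_isolationProb (hμ : UniformMargins μ) :
    Tendsto (fun j : ℕ => ∑ k ∈ Finset.range ((j + 1) ^ 2),
      (1 / ((j : ℝ) + 1)) * isolationProb μ ((k + 1) * (1 / ((j : ℝ) + 1)))) atTop
      (𝓝 ((∫ u in unitSquare, √(μ.rnDeriv volume u).toReal) / 2)) := by
  rw [← hμ.integral_sqrt_rnDeriv, ← integral_div]
  simp only [sum_isolationProb_eq]
  have hne : ∀ᵐ u ∂μ, localDensity μ u ≠ 0 :=
    (Measure.rnDeriv_ne_top (volume : Measure Plane) μ).mono fun u hu => by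
      simpa [localDensity] using hu
  refine tendsto_integral_of_dominated_convergence
    (fun u => √(volume.rnDeriv μ u).toReal / 2)
    (fun j => ((measurable_gaussSum _ _).comp (measurable_localDensity μ)).aestronglyMeasurable)
    (hμ.integrable_sqrt_rnDeriv.div_const 2) (fun j => ?_) ?_
  · filter_upwards [hne] with u hu
    rw [Real.norm_eq_abs, abs_of_nonneg (gaussSum_nonneg (by positivity) _ _)]
    have := gaussSum_le (show 0 < 1 / ((j : ℝ) + 1) by positivity) ((j + 1) ^ 2) hu
    rwa [localDensity, inv_inv] at this
  · filter_upwards [hne] with u hu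
    have := tendsto_gaussSum hu
    rwa [localDensity, inv_inv] at this

theorem UniformMargins.tendsto_nearestNeighbour_average (hμ : UniformMargins μ) {ε : ℝ}
    (hε : 0 < ε) :
    Tendsto (fun n : ℕ => (sampleLaw μ (n + 1)).real {x | ε ≤
      |√(n : ℝ) * (∑ i, nnDist (rankTransform x) i) / ((n : ℝ) + 1) -
        (∫ u in unitSquare, √(μ.rnDeriv volume u).toReal) / 2|}) atTop (𝓝 0) := by
  have := hμ.nullSingletonClass
  set b := (∫ u in unitSquare, √(μ.rnDeriv volume u).toReal) / 2
  -- Five errors: removing the truncation, passing to ranks, discretising the level, replacing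
  -- frequencies by their limits, and the Riemann sum. The grid, indexed by `j`, is fixed before `n`
  -- grows.
  have hε5 : 0 < ε / 5 := by positivity
  obtain ⟨j, hj1, hj2, hj3⟩ : ∃ j : ℕ, |∑ k ∈ Finset.range ((j + 1) ^ 2),
      (1 / ((j : ℝ) + 1)) * isolationProb μ ((k + 1) * (1 / ((j : ℝ) + 1))) - b| < ε / 5 ∧
      1 / ((j : ℝ) + 1) < ε / 5 ∧ 36 / ((j : ℝ) + 1) < ε / 5 := by
    have e1 := (Metric.tendsto_nhds.1 hμ.tendsto_sum_isolationProb) _ hε5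
    have e2 := (tendsto_one_div_add_atTop_nhds_zero_nat (𝕜 := ℝ)).eventually (gt_mem_nhds hε5)
    have e3 := (tendsto_one_div_add_atTop_nhds_zero_nat (𝕜 := ℝ)).eventually
      (gt_mem_nhds (show 0 < ε / 5 / 36 by positivity))
    obtain ⟨j, h1, h2, h3⟩ := (e1.and (e2.and e3)).exists
    refine ⟨j, h1, h2, ?_⟩
    have : 36 / ((j : ℝ) + 1) = 36 * (1 / ((j : ℝ) + 1)) := by ring
    rw [this]; linarith
  set δ : ℝ := 1 / ((j : ℝ) + 1) with hδdef
  set m := (j + 1) ^ 2 with hm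
  have hδ : 0 < δ := by positivity
  have hK : (m : ℝ) * δ = (j : ℝ) + 1 := by rw [hm, hδdef]; push_cast; field_simp
  have hKpos : 0 < (m : ℝ) * δ := by rw [hK]; positivity
  -- The `m` frequencies carry weight `δ` each, so this tolerance makes their total error `ε / 5`.
  have hη : 0 < ε / 5 / (m * δ) := by positivity
  have hlim := (hμ.tendsto_average_rankTransform hKpos hε5).add
    (tendsto_finsetSum (Finset.range m) fun k _ =>
      tendsto_isolated_frequency μ (show 0 < ((k : ℝ) + 1) * δ by positivity) hη)
  simp only [Finset.sum_const_zero, add_zero] at hlim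
  refine tendsto_of_tendsto_of_tendsto_of_le_of_le' tendsto_const_nhds hlim
    (Eventually.of_forall fun n => measureReal_nonneg) ?_
  filter_upwards [eventually_ge_atTop 1] with n hn
  refine (measureReal_mono fun x hx => ?_).trans ((measureReal_union_le _ _).trans
    (add_le_add le_rfl (measureReal_biUnion_finset_le (Finset.range m) fun k : ℕ => {x | ε / 5 / (m * δ)
      ≤ |(∑ i, (isolated i (((k : ℝ) + 1) * δ / √(n : ℝ))).indicator 1 x) / ((n : ℝ) + 1) -
        isolationProb μ (((k : ℝ) + 1) * δ)|})))
  by_contra hcon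
  simp only [mem_union, mem_iUnion, mem_ofPred_eq, not_or, not_le, not_exists] at hcon hx
  obtain ⟨hc1, hc2⟩ := hcon
  have hn1 : (0 : ℝ) < (n : ℝ) + 1 := by positivity
  have d1 := abs_average_sub_average_min_le hn (fun i => rankTransform_mem_unitSquare x i) hKpos
  rw [hK] at d1
  have d2 : |(∑ i, min (√(n : ℝ) * nnDist (rankTransform x) i) (m * δ)) / ((n : ℝ) + 1) -
      (∑ i, min (√(n : ℝ) * nnDist x i) (m * δ)) / ((n : ℝ) + 1)| < ε / 5 := by
    refine lt_of_le_of_lt ?_ hc1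
    rw [← sub_div, ← Finset.sum_sub_distrib, abs_div, abs_of_pos hn1]
    gcongr
    exact Finset.abs_sum_le_sum_abs _ _
  rw [hK] at d2
  have d3 := abs_average_min_sub_sum_frequency_le hn hδ m x
  rw [hK] at d3
  have d4 : |∑ k ∈ Finset.range m, δ * ((∑ i, (isolated i ((k + 1) * δ / √(n : ℝ))).indicator 1 x) /
      ((n : ℝ) + 1)) - ∑ k ∈ Finset.range m, δ * isolationProb μ ((k + 1) * δ)| ≤ ε / 5 := by
    rw [← Finset.sum_sub_distrib]
    calc _ ≤ ∑ k ∈ Finset.range m, δ * (ε / 5 / (m * δ)) := by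
          refine (Finset.abs_sum_le_sum_abs _ _).trans (Finset.sum_le_sum fun k hk => ?_)
          rw [← mul_sub, abs_mul, abs_of_pos hδ]
          exact mul_le_mul_of_nonneg_left (hc2 k hk).le hδ.le
      _ = ε / 5 := by
          rw [Finset.sum_const, Finset.card_range, nsmul_eq_mul, ← mul_assoc,
            mul_div_cancel₀ _ hKpos.ne']
  refine absurd hx (not_le.2 ?_)
  rw [abs_lt] at hj1 d2 ⊢
  rw [abs_le] at d1 d3 d4
  constructor <;> linarith [hj1.1, hj1.2, d2.1, d2.2, d1.1, d1.2, d3.1, d3.2, d4.1, d4.2]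

end Limit

/-! ### The probability integral transform -/

/-- For `0 ≤ t < 1` the sublevel set of the distribution function is empty or a closed half-line;
continuity makes the value at its endpoint exactly `t`. -/
theorem map_cdf_eq_volume_restrict (ν : Measure ℝ) [IsProbabilityMeasure ν]
    (hc : Continuous (cdf ν)) : ν.map (cdf ν) = volume.restrict (Icc (0 : ℝ) 1) := by
  have hm : Measurable (cdf ν) := hc.measurable
  have : IsProbabilityMeasure (ν.map (cdf ν)) := Measure.isProbabilityMeasure_map hm.aemeasurable
  refine Measure.ext_of_Iic _ _ fun t => ?_
  rw [Measure.map_apply hm measurableSet_Iic, Measure.restrict_apply measurableSet_Iic]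
  rcases lt_or_ge t 0 with ht0 | ht0
  · have h1 : cdf ν ⁻¹' Iic t = ∅ := by
      ext v; simp only [mem_preimage, mem_Iic, mem_empty_iff_false, iff_false, not_le]
      exact ht0.trans_le (cdf_nonneg ν v)
    have h2 : Iic t ∩ Icc (0 : ℝ) 1 = ∅ := by
      ext v; simp only [mem_inter_iff, mem_Iic, mem_Icc, mem_empty_iff_false, iff_false]
      rintro ⟨a, b, -⟩; linarith
    rw [h1, h2, measure_empty, measure_empty]
  rcases le_or_gt 1 t with ht1 | ht1
  · have h1 : cdf ν ⁻¹' Iic t = univ := by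
      ext v; simp only [mem_preimage, mem_Iic, mem_univ, iff_true]
      exact (cdf_le_one ν v).trans ht1
    have h2 : Iic t ∩ Icc (0 : ℝ) 1 = Icc 0 1 :=
      inter_eq_self_of_subset_right fun v hv => hv.2.trans ht1
    rw [h1, h2, measure_univ, Real.volume_Icc]
    simp
  have h2 : Iic t ∩ Icc (0 : ℝ) 1 = Icc 0 t := by
    ext v; simp only [mem_inter_iff, mem_Iic, mem_Icc]
    constructor
    · rintro ⟨a, b, -⟩; exact ⟨b, a⟩
    · rintro ⟨a, b⟩; exact ⟨b, a, b.trans ht1.le⟩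
  rw [h2, Real.volume_Icc, sub_zero]
  set s := cdf ν ⁻¹' Iic t with hs
  rcases s.eq_empty_or_nonempty with he | hne
  · have hle : t ≤ 0 := ge_of_tendsto (tendsto_cdf_atBot ν) (Eventually.of_forall fun v => by
      by_contra hv
      have : v ∈ s := (not_le.1 hv).le
      rw [he] at this
      exact this)
    rw [he, measure_empty, ENNReal.ofReal_of_nonpos hle]
  have hbdd : BddAbove s := by
    obtain ⟨v, hv⟩ := ((tendsto_cdf_atTop ν).eventually (lt_mem_nhds ht1)).exists
    refine ⟨v, fun w hw => ?_⟩
    by_contra hvw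
    exact absurd (((monotone_cdf ν) (not_le.1 hvw).le).trans hw) (not_le.2 hv)
  have hclosed : IsClosed s := isClosed_Iic.preimage hc
  have hz : sSup s ∈ s := hclosed.csSup_mem hne hbdd
  have hsIic : s = Iic (sSup s) := by
    ext v
    exact ⟨fun hv => le_csSup hbdd hv, fun hv => ((monotone_cdf ν) hv).trans hz⟩
  have hval : cdf ν (sSup s) = t := by
    refine le_antisymm hz ?_
    have hright : Tendsto (cdf ν) (𝓝[>] (sSup s)) (𝓝 (cdf ν (sSup s))) :=
      hc.continuousAt.tendsto.mono_left nhdsWithin_le_nhds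
    refine ge_of_tendsto hright (eventually_nhdsWithin_of_forall fun v hv => ?_)
    by_contra hvt
    exact absurd (le_csSup hbdd (show v ∈ s from (not_le.1 hvt).le)) (not_le.2 hv)
  rw [hsIic, ← ofReal_cdf, hval]

/-! ### Reduction to a sample with uniform margins -/

section Copula

variable {Ω : Type*} [MeasurableSpace Ω] {P : Measure Ω} [IsProbabilityMeasure P]

/-- The coordinatewise transform of the plane by the distribution functions of the margins. -/
noncomputable def cdfTransform (P : Measure Ω) (V Y : Ω → ℝ) (z : ℝ × ℝ) : Plane :=
  !₂[cdf (P.map V) z.1, cdf (P.map Y) z.2]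

theorem measurable_cdf (ν : Measure ℝ) : Measurable (cdf ν) := (monotone_cdf ν).measurable

omit [IsProbabilityMeasure P] in
theorem measurable_cdfTransform (V Y : Ω → ℝ) : Measurable (cdfTransform P V Y) := by
  unfold cdfTransform
  refine (PiLp.continuous_toLp 2 _).measurable.comp (measurable_pi_iff.2 fun k => ?_)
  fin_cases k
  · exact (measurable_cdf _).comp measurable_fst
  · exact (measurable_cdf _).comp measurable_snd

theorem uniformMargins_copula {V Y : Ω → ℝ} (hV : Measurable V) (hY : Measurable Y)
    (hcV : Continuous (cdf (P.map V))) (hcY : Continuous (cdf (P.map Y))) :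
    UniformMargins (copula P V Y) := by
  have : IsProbabilityMeasure (P.map V) := Measure.isProbabilityMeasure_map hV.aemeasurable
  have : IsProbabilityMeasure (P.map Y) := Measure.isProbabilityMeasure_map hY.aemeasurable
  have hm : Measurable fun ω => (!₂[cdf (P.map V) (V ω), cdf (P.map Y) (Y ω)] : Plane) :=
    (measurable_cdfTransform (P := P) V Y).comp (hV.prodMk hY)
  intro k
  unfold copula
  rw [Measure.map_map (by fun_prop) hm]
  fin_cases k
  · rw [← map_cdf_eq_volume_restrict _ hcV, Measure.map_map (measurable_cdf _) hV]
    rfl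
  · rw [← map_cdf_eq_volume_restrict _ hcY, Measure.map_map (measurable_cdf _) hY]
    rfl

/-- Strict monotonicity of `F` is not needed: the absence of ties among the transformed values
excludes order reversals. -/
theorem empiricalCdf_comp_of_injective {n : ℕ} {F : ℝ → ℝ} (hF : Monotone F) {v : Fin n → ℝ}
    (h : Function.Injective fun i => F (v i)) (i : Fin n) :
    empiricalCdf (fun j => F (v j)) (F (v i)) = empiricalCdf v (v i) := by
  rw [empiricalCdf_eq, empiricalCdf_eq]
  congr 1
  refine Finset.sum_congr rfl fun j _ => ?_
  have : F (v j) ≤ F (v i) ↔ v j ≤ v i := by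
    refine ⟨fun hle => ?_, fun hle => hF hle⟩
    by_contra hlt
    have hji : j = i := h (le_antisymm hle (hF (not_le.1 hlt).le))
    exact hlt (by rw [hji])
  simp [this]

theorem UniformMargins.ae_injective {μ : Measure Plane} [IsProbabilityMeasure μ]
    (hμ : UniformMargins μ) (n : ℕ) (k : Fin 2) :
    ∀ᵐ x ∂(sampleLaw μ (n + 1)), Function.Injective fun i => x i k := by
  have h : ∀ i (j : Fin n), ∀ᵐ x ∂(sampleLaw μ (n + 1)), x (i.succAbove j) k ≠ x i k := by
    intro i j
    have hD : MeasurableSet {z : Plane × (Fin n → Plane) | z.2 j k = z.1 k} :=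
      measurableSet_eq_fun (by fun_prop) (by fun_prop)
    suffices hz : sampleLaw μ (n + 1) {x | x (i.succAbove j) k = x i k} = 0 from
      measure_eq_zero_iff_ae_notMem.1 hz
    refine (sampleLaw_cond μ i hD).trans ?_
    refine lintegral_eq_zero_of_ae_eq_zero (ae_of_all _ fun u => ?_)
    have := (measurePreserving_eval (fun _ : Fin n => μ) j).measure_preimage
      (show MeasurableSet {v : Plane | v k = u k} from
        measurableSet_eq_fun (by fun_prop) measurable_const).nullMeasurableSet
    exact this.trans (hμ.measure_eq k (u k))
  have h' := ae_all_iff.2 fun i => ae_all_iff.2 (h i)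
  filter_upwards [h'] with x hx i j hij
  by_contra hne
  obtain ⟨l, hl⟩ := Fin.exists_succAbove_eq hne
  exact hx j l (by rw [hl]; exact hij)

theorem map_cdfTransform_sample {V Y : Ω → ℝ} {Z : ℕ → Ω → ℝ × ℝ} (hZ : ∀ i, Measurable (Z i))
    (hindep : iIndepFun Z P) (hident : ∀ i, IdentDistrib (Z i) (fun ω => (V ω, Y ω)) P P) (n : ℕ) :
    P.map (fun ω (i : Fin n) => cdfTransform P V Y (Z i ω)) = sampleLaw (copula P V Y) n := by
  have hT := measurable_cdfTransform (P := P) V Y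
  have h1 : iIndepFun (fun i : Fin n => fun ω => cdfTransform P V Y (Z i ω)) P :=
    (hindep.comp (fun _ => cdfTransform P V Y) fun _ => hT).precomp Fin.val_injective
  have h2 : ∀ i : Fin n, AEMeasurable (fun ω => cdfTransform P V Y (Z i ω)) P := fun i =>
    (hT.comp (hZ i)).aemeasurable
  rw [(iIndepFun_iff_map_fun_eq_pi_map h2).1 h1]
  congr with i : 1
  exact ((hident i).comp hT).map_eq

theorem bhattacharyyaEst_eq {n : ℕ} (x : Fin (n + 1) → Plane) :
    bhattacharyyaEst (fun i => x i 0) (fun i => x i 1) =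
      2 * (√(n : ℝ) * (∑ i, nnDist (rankTransform x) i) / ((n : ℝ) + 1)) := by
  unfold bhattacharyyaEst rankTransform
  push_cast
  rw [add_sub_cancel_right]
  ring

theorem tendstoInMeasure_bhattacharyyaEst {V Y : Ω → ℝ} (hV : Measurable V) (hY : Measurable Y)
    (hcV : Continuous (cdf (P.map V))) (hcY : Continuous (cdf (P.map Y)))
    {Z : ℕ → Ω → ℝ × ℝ} (hZ : ∀ i, Measurable (Z i)) (hindep : iIndepFun Z P)
    (hident : ∀ i, IdentDistrib (Z i) (fun ω => (V ω, Y ω)) P P) :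
    TendstoInMeasure P
      (fun (n : ℕ) ω => bhattacharyyaEst (fun i : Fin n => (Z i ω).1) (fun i : Fin n => (Z i ω).2))
      atTop (fun _ => bhattacharyya P V Y) := by
  have hμ := uniformMargins_copula hV hY hcV hcY
  have hT := measurable_cdfTransform (P := P) V Y
  have hprob : IsProbabilityMeasure (copula P V Y) :=
    Measure.isProbabilityMeasure_map (hT.comp (hV.prodMk hY)).aemeasurable
  rw [tendstoInMeasure_iff_dist]
  intro ε hε
  rw [← tendsto_add_atTop_iff_nat 1]
  have hlim := (ENNReal.continuous_ofReal.tendsto 0).comp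
    (hμ.tendsto_nearestNeighbour_average (half_pos hε))
  rw [ENNReal.ofReal_zero] at hlim
  refine tendsto_of_tendsto_of_tendsto_of_le_of_le tendsto_const_nhds hlim
    (fun n => zero_le) (fun n => ?_)
  set f : Ω → Fin (n + 1) → Plane := fun ω i => cdfTransform P V Y (Z i ω) with hf
  have hfm : Measurable f := measurable_pi_iff.2 fun i => hT.comp (hZ i)
  have hmap : P.map f = sampleLaw (copula P V Y) (n + 1) := map_cdfTransform_sample hZ hindep hident _
  have hinj : ∀ᵐ ω ∂P, ∀ k : Fin 2, Function.Injective fun i => f ω i k := by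
    have := ae_all_iff.2 fun k => hμ.ae_injective n k
    rw [← hmap] at this
    exact ae_of_ae_map hfm.aemeasurable this
  simp only [Function.comp_apply]
  rw [ofReal_measureReal, ← hmap]
  -- Only an upper bound is needed, so the event need not be shown measurable.
  refine le_trans (measure_mono_ae ?_) (Measure.le_map_apply hfm.aemeasurable _)
  filter_upwards [hinj] with ω hω hx
  have e : bhattacharyyaEst (fun i : Fin (n + 1) => (Z i ω).1) (fun i : Fin (n + 1) => (Z i ω).2) =
      2 * (√(n : ℝ) * (∑ i, nnDist (rankTransform (f ω)) i) / ((n : ℝ) + 1)) := by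
    rw [← bhattacharyyaEst_eq]
    have hp : pseudoObs (fun i : Fin (n + 1) => (Z i ω).1) (fun i : Fin (n + 1) => (Z i ω).2) =
        pseudoObs (fun i => f ω i 0) (fun i => f ω i 1) := by
      funext i
      unfold pseudoObs
      have e0 := empiricalCdf_comp_of_injective (monotone_cdf (P.map V)) (hω 0) i
      have e1 := empiricalCdf_comp_of_injective (monotone_cdf (P.map Y)) (hω 1) i
      rw [← e0, ← e1]
      rfl
    unfold bhattacharyyaEst
    rw [hp]
  change ε / 2 ≤ |√(n : ℝ) * (∑ i, nnDist (rankTransform (f ω)) i) / ((n : ℝ) + 1) -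
    bhattacharyya P V Y / 2|
  have hx' : ε ≤ dist (bhattacharyyaEst (fun i : Fin (n + 1) => (Z i ω).1)
    (fun i : Fin (n + 1) => (Z i ω).2)) (bhattacharyya P V Y) := hx
  rw [e, Real.dist_eq] at hx'
  rw [show 2 * (√(n : ℝ) * (∑ i, nnDist (rankTransform (f ω)) i) / ((n : ℝ) + 1)) -
    bhattacharyya P V Y = 2 * (√(n : ℝ) * (∑ i, nnDist (rankTransform (f ω)) i) / ((n : ℝ) + 1) -
    bhattacharyya P V Y / 2) by ring, abs_mul, abs_two] at hx'
  linarith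

end Copula

/-! ### Continuity of the map to the Hellinger correlation -/

/-- With `r = √(4 - 3x⁴)`, both `x⁴ + r - 2 = (2 - r)(r - 1)/3` and `x⁴ = (2 - r)(2 + r)/3` contain
the factor `2 - r`; cancelling it removes the singularity at `0`. -/
theorem hellingerMap_eq_of_pow_le {x : ℝ} (hx : x ≠ 0) (h : x ^ 4 ≤ 4 / 3) :
    hellingerMap x = 2 * √(1 - 3 / (2 + √(4 - 3 * x ^ 4))) := by
  have hx4 : 0 < x ^ 4 := by positivity
  set r := √(4 - 3 * x ^ 4) with hr
  have hr0 : 0 ≤ r := Real.sqrt_nonneg _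
  have hr2 : r ^ 2 = 4 - 3 * x ^ 4 := Real.sq_sqrt (by linarith)
  have e : x ^ 4 + r - 2 = (x ^ 2) ^ 2 * (1 - 3 / (2 + r)) := by
    have h2 : 2 + r ≠ 0 := by positivity
    field_simp
    nlinarith
  unfold hellingerMap
  rw [if_neg hx, ← hr, e, Real.sqrt_mul (sq_nonneg _), Real.sqrt_sq (sq_nonneg x), ← mul_assoc,
    div_mul_cancel₀ _ (pow_ne_zero 2 hx)]

theorem continuous_hellingerMap : Continuous hellingerMap := by
  rw [continuous_iff_continuousAt]
  intro x
  by_cases hx : x = 0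
  · subst hx
    have hev : hellingerMap =ᶠ[𝓝 0] fun x => 2 * √(1 - 3 / (2 + √(4 - 3 * x ^ 4))) := by
      have hc : ContinuousAt (fun x : ℝ => x ^ 4) 0 := by fun_prop
      have := hc.eventually (gt_mem_nhds (show (0 : ℝ) ^ 4 < 4 / 3 by norm_num))
      filter_upwards [this] with y hy
      by_cases hy0 : y = 0
      · subst hy0
        have h4 : √(4 : ℝ) = 2 := by
          rw [show (4 : ℝ) = 2 ^ 2 by norm_num]; exact Real.sqrt_sq (by norm_num)
        have h1 : √(1 - 3 / (2 + 2) : ℝ) = 1 / 2 := by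
          rw [show (1 - 3 / (2 + 2) : ℝ) = (1 / 2) ^ 2 by norm_num]; exact Real.sqrt_sq (by norm_num)
        simp [hellingerMap, h4, h1]
      · exact hellingerMap_eq_of_pow_le hy0 hy.le
    refine ContinuousAt.congr ?_ hev.symm
    have hpos : ∀ x : ℝ, 2 + √(4 - 3 * x ^ 4) ≠ 0 := fun x => by positivity
    exact (continuous_const.mul (continuous_const.sub
      (continuous_const.div (by fun_prop) hpos)).sqrt).continuousAt
  · have hev : hellingerMap =ᶠ[𝓝 x] fun x => 2 / x ^ 2 * √(x ^ 4 + √(4 - 3 * x ^ 4) - 2) := by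
      filter_upwards [isOpen_ne.mem_nhds hx] with y hy
      exact if_neg hy
    refine ContinuousAt.congr ?_ hev.symm
    refine ContinuousAt.mul (ContinuousAt.div continuousAt_const (by fun_prop) (pow_ne_zero 2 hx)) ?_
    exact Continuous.continuousAt (by fun_prop)

theorem tendstoInMeasure_comp_const {Ω : Type*} [MeasurableSpace Ω] {P : Measure Ω}
    {f : ℕ → Ω → ℝ} {b : ℝ} (h : TendstoInMeasure P f atTop fun _ => b) {g : ℝ → ℝ}
    (hg : ContinuousAt g b) :
    TendstoInMeasure P (fun n ω => g (f n ω)) atTop fun _ => g b := by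
  rw [tendstoInMeasure_iff_dist] at h ⊢
  intro ε hε
  obtain ⟨δ, hδ, H⟩ := Metric.continuousAt_iff.1 hg ε hε
  refine tendsto_of_tendsto_of_tendsto_of_le_of_le tendsto_const_nhds (h δ hδ)
    (fun n => zero_le) (fun n => measure_mono fun ω hω => ?_)
  by_contra hlt
  exact absurd hω (not_le.2 (H (not_le.1 hlt)))

end HellingerSDR

theorem theorem3 {Ω : Type*} [MeasurableSpace Ω] (P : Measure Ω) [IsProbabilityMeasure P]
    (p : ℕ)
    -- the population pair
    (X : Ω → EuclideanSpace ℝ (Fin p)) (Y : Ω → ℝ) (hX : Measurable X) (hY : Measurable Y)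
    -- the random sample: independent copies of the population pair
    (Xs : ℕ → Ω → EuclideanSpace ℝ (Fin p)) (Ys : ℕ → Ω → ℝ)
    (hXs : ∀ i, Measurable (Xs i)) (hYs : ∀ i, Measurable (Ys i))
    (hindep : iIndepFun (fun i ω => (Xs i ω, Ys i ω)) P)
    (hident : ∀ i, IdentDistrib (fun ω => (Xs i ω, Ys i ω)) (fun ω => (X ω, Y ω)) P P)
    -- a direction on the unit sphere
    (α : EuclideanSpace ℝ (Fin p)) (hα : α ∈ Metric.sphere (0 : EuclideanSpace ℝ (Fin p)) 1)
    -- the projected predictor and the response have continuous distributions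
    (hcX : Continuous (cdf (P.map (fun ω => inner ℝ α (X ω)))))
    (hcY : Continuous (cdf (P.map Y))) :
    TendstoInMeasure P
      (fun (n : ℕ) (ω : Ω) =>
        HellingerSDR.hellingerEst (fun i : Fin n => inner ℝ α (Xs i ω)) (fun i : Fin n => Ys i ω))
      atTop
      (fun _ => HellingerSDR.hellingerCorrelation P (fun ω => inner ℝ α (X ω)) Y) := by
  refine HellingerSDR.tendstoInMeasure_comp_const ?_
    HellingerSDR.continuous_hellingerMap.continuousAt
  have hproj : Measurable fun z : EuclideanSpace ℝ (Fin p) × ℝ => (inner ℝ α z.1, z.2) := by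
    fun_prop
  exact HellingerSDR.tendstoInMeasure_bhattacharyyaEst (V := fun ω => inner ℝ α (X ω)) (Y := Y)
    (Z := fun i ω => (inner ℝ α (Xs i ω), Ys i ω)) (by fun_prop) hY hcX hcY
    (fun i => hproj.comp ((hXs i).prodMk (hYs i)))
    (hindep.comp (fun _ z => (inner ℝ α z.1, z.2)) fun _ => hproj)
    (fun i => (hident i).comp hproj)
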